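/- Let $\mathbb{K}$ be an algebraically closed field of characteristic zero. An affine monoid is an irreducible normal affine algebraic variety $X$ over $\mathbb{K}$ with an associative multiplication $X\times X\to X$, $(x,y)\mapsto x*y$, that is a morphism of varieties and has a unity $1\in X$. Let $G(X)$ be its group of invertible elements, which is an affine algebraic group, open in $X$. Let $E(X)=\{x\in X\mid x*x=x\}$ be the set of idempotents, with the Zariski topology induced from $X$, and let $Z(X)=\{x\in X\mid x*y=y*x\ \ \forall y\in X\}$ be the center. The conjugacy class of $x\in X$ is the orbit $\{g*x*g^{-1}\mid g\in G(X)\}$. Suppose that $X$ has corank one, i.e. that a maximal torus of $G(X)$ has codimension one in $G(X)$. Then every irreducible component of $E(X)$ is a conjugacy class of $X$. In particular, the irreducible components of $E(X)$ that are isomorphic to the affine line do not meet $Z(X)$, and the isolated points of $E(X)$ belong to $Z(X)$. -/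

import Mathlib

namespace AffineMonoid

/-- The closed points of the affine variety `X` over `K` with coordinate ring `A`, that is, the
`K`-algebra homomorphisms `A → K`. When `A` is a bialgebra over `K`, this type carries (by
Mathlib's convolution product) the multiplication `(x * y)(a) = (x ⊗ y)(Δ a)` dual to the
comultiplication `Δ : A → A ⊗ A`, and the unity is the counit. -/
abbrev Pt (K A : Type*) [Field K] [CommRing A] [Algebra K A] : Type _ :=
  WithConv (A →ₐ[K] K)

/-- The maximal ideal of regular functions that vanish at the point `x`, as a prime ideal. -/
def toPrimeSpectrum (K A : Type*) [Field K] [CommRing A] [Algebra K A] (x : Pt K A) :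
    PrimeSpectrum A :=
  ⟨RingHom.ker x.ofConv, RingHom.ker_isPrime x.ofConv⟩

/-- The Zariski topology on the closed points. -/
instance zariskiTopology (K A : Type*) [Field K] [CommRing A] [Algebra K A] :
    TopologicalSpace (Pt K A) :=
  TopologicalSpace.induced (toPrimeSpectrum K A) inferInstance

/-- The Zariski closed sets are the zero loci of sets of regular functions. -/
theorem isClosed_iff_zeroLocus {K A : Type*} [Field K] [CommRing A] [Algebra K A]
    (C : Set (Pt K A)) :
    IsClosed C ↔ ∃ S : Set A, C = {x | ∀ a ∈ S, x.ofConv a = 0} := by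
  rw [isClosed_induced_iff]
  constructor
  · rintro ⟨t, ht, rfl⟩
    obtain ⟨S, rfl⟩ := (PrimeSpectrum.isClosed_iff_zeroLocus t).1 ht
    exact ⟨S, rfl⟩
  · rintro ⟨S, rfl⟩
    exact ⟨_, PrimeSpectrum.isClosed_zeroLocus S, rfl⟩

/-- The ideal of regular functions that vanish on a set of points. -/
def vanishingIdeal {K A : Type*} [Field K] [CommRing A] [Algebra K A] (C : Set (Pt K A)) :
    Ideal A :=
  ⨅ x ∈ C, RingHom.ker x.ofConv

/-- `C` is a closed subvariety isomorphic to the affine line: its coordinate ring is isomorphic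
to the polynomial ring in one variable as a `K`-algebra. -/
def IsAffineLine {K A : Type*} [Field K] [CommRing A] [Algebra K A] (C : Set (Pt K A)) : Prop :=
  IsClosed C ∧ Nonempty ((A ⧸ vanishingIdeal C) ≃ₐ[K] Polynomial K)

/-- The set `E(X)` of idempotents. -/
def idempotents (K A : Type*) [Field K] [CommRing A] [Bialgebra K A] : Set (Pt K A) :=
  {x | x * x = x}

/-- The conjugacy class of `x`: its orbit under `x ↦ g * x * g⁻¹`, where `g` runs over the group
of invertible elements of `X`. -/
def conjClass {K A : Type*} [Field K] [CommRing A] [Bialgebra K A] (x : Pt K A) :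
    Set (Pt K A) :=
  {y | ∃ g : (Pt K A)ˣ, y = (g : Pt K A) * x * ((g⁻¹ : (Pt K A)ˣ) : Pt K A)}

/-- The value of the Laurent polynomial `f = ∑ c_m t^m` at a point of the torus `(Kˣ)^r`. -/
noncomputable def evalLaurent {K : Type*} [Field K] {r : ℕ} (f : (Fin r → ℤ) →₀ K)
    (t : Fin r → Kˣ) : K :=
  f.sum fun m c => c * ∏ i, ((t i ^ m i : Kˣ) : K)

/-- `T` is a torus of dimension `r` in the group of invertible elements of `X`: it is the image
of an injective group homomorphism from `(Kˣ)^r` that is a morphism of varieties, i.e. that pulls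
regular functions on `X` back to Laurent polynomials. (Such an image is automatically a closed
subgroup.) -/
def IsTorus {K A : Type*} [Field K] [CommRing A] [Bialgebra K A] (T : Subgroup (Pt K A)ˣ)
    (r : ℕ) : Prop :=
  ∃ φ : (Fin r → Kˣ) →* (Pt K A)ˣ, Function.Injective φ ∧ φ.range = T ∧
    ∀ a : A, ∃ f : (Fin r → ℤ) →₀ K, ∀ t, (φ t : Pt K A).ofConv a = evalLaurent f t

/-- The monoid `X` has corank `c`: a maximal torus (for inclusion) in its group of invertible
elements has codimension `c`. The group is open in the irreducible variety `X`, so its dimension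
is that of `X`, which is the Krull dimension of the coordinate ring. -/
def HasCorank (K A : Type*) [Field K] [CommRing A] [Bialgebra K A] (c : ℕ) : Prop :=
  ∃ (T : Subgroup (Pt K A)ˣ) (r : ℕ), IsTorus T r ∧
    Maximal (fun S : Subgroup (Pt K A)ˣ => ∃ s, IsTorus S s) T ∧
    ringKrullDim A = ((r + c : ℕ) : WithBot ℕ∞)

end AffineMonoid

/-! Let T be a torus of rank r in G(X), where dim X = r + 1, and split K[X] into the spaces of
weight (l, m) under left and right translations by T. The basic tool is `eq_zero_of_vanishing`: an
irreducible set that contains a translate Tg and a point outside the closure of Tg is dense, because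
there is no room for a proper closed irreducible set in between. Two cases arise.

Suppose a weight with l ≠ m occurs. Then TgT is dense for general g, so every weight space has
dimension at most one (`weightSpace_mul_eq`) and all differences m - l lie on one ray
(`weight_sub_mul_eq`, `exists_isToric`). The function χ_l of weight (l, l), normalized at 1, is
therefore multiplicative; it takes only the values 0 and 1 on idempotents and is constant on
irreducible sets of idempotents. Conversely, idempotents with equal χ-values are conjugate
(`IsToric.mem_conjClass`): if each is nonzero on some off-diagonal weight vector, an element of T
conjugates one into the other, and the remaining cases reduce to this one or to equality.

Suppose all weights are diagonal. Then T is central and X is commutative (`IsDiagonal.mul_comm`). If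
two independent class functions share a weight, T times a general conjugacy class is not dense, and
this forces every weight vector to be a class function. Otherwise class functions are determined by
their weights, and an argument with traces (`scalar_of_trace_mul`) shows that G(X) acts on the
translates of each weight vector by scalars. In a commutative X the ranks of idempotent operators
are constant on irreducible sets, so irreducible sets of idempotents are points.

In both cases an irreducible set of idempotents lies in one conjugacy class. Classes are irreducible
(`irr_conjClass`), so components are classes. The class of a central element is a point, and an
isolated idempotent is both dense and closed in its class. -/

namespace AffineMonoid

/-! ### Closed points and the Nullstellensatz -/

section Points

variable {K A : Type*} [Field K] [CommRing A] [Algebra K A]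

/-- Nullstellensatz: a regular function that is not zero has a point where it does not vanish. -/
theorem exists_eval_ne_zero [IsAlgClosed K] [IsDomain A] [Algebra.FiniteType K A] {a : A}
    (ha : a ≠ 0) : ∃ x : Pt K A, x.ofConv a ≠ 0 := by
  -- Points of the localization at `a` are the points where `a` does not vanish; the residue field
  -- of a maximal ideal there is finite over `K`, hence equal to `K`.
  let L := Localization.Away a
  have : Nontrivial L := by
    have : Submonoid.powers a ≤ nonZeroDivisors A :=
      powers_le_nonZeroDivisors_of_noZeroDivisors ha
    exact (IsLocalization.injective L this).nontrivial
  have : Algebra.FiniteType A L := IsLocalization.finiteType_of_monoid_fg (Submonoid.powers a) L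
  have : Algebra.FiniteType K L := Algebra.FiniteType.trans (S := A) inferInstance inferInstance
  obtain ⟨m, hm⟩ := Ideal.exists_maximal L
  let : Field (L ⧸ m) := Ideal.Quotient.field m
  have : Algebra.FiniteType K (L ⧸ m) :=
    Algebra.FiniteType.of_surjective (Ideal.Quotient.mkₐ K m) (Ideal.Quotient.mkₐ_surjective K m)
  have : Module.Finite K (L ⧸ m) := finite_of_finite_type_of_isJacobsonRing K (L ⧸ m)
  have hb : Function.Bijective (algebraMap K (L ⧸ m)) :=
    IsAlgClosed.algebraMap_bijective_of_isIntegral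
  let e : K ≃ₐ[K] (L ⧸ m) := AlgEquiv.ofBijective (Algebra.ofId K (L ⧸ m)) hb
  let f : A →ₐ[K] (L ⧸ m) := (Ideal.Quotient.mkₐ K m).comp (IsScalarTower.toAlgHom K A L)
  refine ⟨WithConv.toConv (e.symm.toAlgHom.comp f), ?_⟩
  have hu : IsUnit (f a) :=
    (IsLocalization.Away.algebraMap_isUnit (S := L) a).map (Ideal.Quotient.mkₐ K m)
  have : IsUnit (e.symm (f a)) := hu.map e.symm
  exact this.ne_zero

theorem eq_of_eval_eq [IsAlgClosed K] [IsDomain A] [Algebra.FiniteType K A] {a b : A}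
    (h : ∀ x : Pt K A, x.ofConv a = x.ofConv b) : a = b := by
  by_contra hab
  obtain ⟨x, hx⟩ := exists_eval_ne_zero (K := K) (sub_ne_zero.2 hab)
  exact hx (by rw [map_sub, h, sub_self])

theorem Pt.ext {x y : Pt K A} (h : ∀ a, x.ofConv a = y.ofConv a) : x = y := by
  have : x.ofConv = y.ofConv := AlgHom.ext h
  cases x; cases y; simpa using this

theorem Pt.ext_of_span {x y : Pt K A} {S : Set A} (hS : Submodule.span K S = ⊤)
    (h : ∀ a ∈ S, x.ofConv a = y.ofConv a) : x = y := by
  apply Pt.ext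
  intro a
  have ha : a ∈ Submodule.span K S := hS ▸ Submodule.mem_top
  induction ha using Submodule.span_induction with
  | mem a ha => exact h a ha
  | zero => simp
  | add a b _ _ h1 h2 => simp [h1, h2]
  | smul c a _ h1 => simp [h1]

end Points

/-- The kernels of the powers of `f` stabilize; an element killed by `f`, written as `f ^ n` of some
`b`, puts `b` in the next kernel and hence already in the kernel of `f ^ n`. -/
theorem injective_of_surjective_endomorphism {R : Type*} [CommRing R] [IsNoetherianRing R]
    (f : R →+* R) (hf : Function.Surjective f) : Function.Injective f := by
  have hmono : Monotone fun n : ℕ => RingHom.ker (f ^ n) := by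
    refine monotone_nat_of_le_succ fun n a ha => ?_
    rw [RingHom.mem_ker] at ha ⊢
    rw [pow_succ', RingHom.mul_def, RingHom.comp_apply, ha, map_zero]
  obtain ⟨n, hn⟩ := monotone_stabilizes_iff_noetherian.2 ‹IsNoetherianRing R› ⟨_, hmono⟩
  rw [injective_iff_map_eq_zero]
  intro a ha
  have hs : ∀ k : ℕ, Function.Surjective (f ^ k) := by
    intro k
    induction k with
    | zero => exact fun b => ⟨b, rfl⟩
    | succ k ih => rw [pow_succ']; exact hf.comp ih
  obtain ⟨b, rfl⟩ := hs n a
  have h1 : b ∈ RingHom.ker (f ^ (n + 1)) := by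
    rw [RingHom.mem_ker, pow_succ', RingHom.mul_def, RingHom.comp_apply, ha]
  have h2 : RingHom.ker (f ^ n) = RingHom.ker (f ^ (n + 1)) := hn (n + 1) (Nat.le_succ n)
  rwa [← h2] at h1

/-! ### Translations, matrix coefficients and the group of units -/

section Translations

variable {K A : Type*} [Field K] [CommRing A] [Bialgebra K A]

/-- The right translation `a ↦ (y ↦ a (y * x))` of regular functions. -/
noncomputable def rtrans (x : Pt K A) : A →ₐ[K] A :=
  (Algebra.TensorProduct.lift (AlgHom.id K A) ((Algebra.ofId K A).comp x.ofConv)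
    (fun _ _ => Commute.all _ _)).comp (Bialgebra.comulAlgHom K A)

/-- The left translation `a ↦ (y ↦ a (x * y))` of regular functions. -/
noncomputable def ltrans (x : Pt K A) : A →ₐ[K] A :=
  (Algebra.TensorProduct.lift ((Algebra.ofId K A).comp x.ofConv) (AlgHom.id K A)
    (fun _ _ => Commute.all _ _)).comp (Bialgebra.comulAlgHom K A)

theorem exists_comul (a : A) : ∃ s : Finset (A × A),
    (∀ x y : Pt K A, (x * y).ofConv a = ∑ p ∈ s, x.ofConv p.1 * y.ofConv p.2) ∧
    (∀ x : Pt K A, rtrans x a = ∑ p ∈ s, x.ofConv p.2 • p.1) ∧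
    (∀ x : Pt K A, ltrans x a = ∑ p ∈ s, x.ofConv p.1 • p.2) := by
  classical
  obtain ⟨s, hs⟩ := TensorProduct.exists_finset (R := K) (Coalgebra.comul (R := K) a)
  refine ⟨s, fun x y => ?_, fun x => ?_, fun x => ?_⟩
  · have : (x * y).ofConv a = (Algebra.TensorProduct.lift x.ofConv y.ofConv
      (fun _ _ => Commute.all _ _)) (Coalgebra.comul (R := K) a) := by
      change Algebra.TensorProduct.lmul' K (Algebra.TensorProduct.map x.ofConv y.ofConv
        (Coalgebra.comul (R := K) a)) = _
      rw [hs, map_sum, map_sum, map_sum]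
      simp
    rw [this, hs, map_sum]
    simp
  · simp [rtrans, hs, Algebra.smul_def, mul_comm, Algebra.ofId_apply]
  · simp [ltrans, hs, Algebra.smul_def, Algebra.ofId_apply]

theorem eval_rtrans (x y : Pt K A) (a : A) : y.ofConv (rtrans x a) = (y * x).ofConv a := by
  obtain ⟨s, h1, h2, -⟩ := exists_comul (K := K) a
  rw [h1, h2, map_sum]
  simp [mul_comm]

theorem eval_ltrans (x y : Pt K A) (a : A) : y.ofConv (ltrans x a) = (x * y).ofConv a := by
  obtain ⟨s, h1, -, h2⟩ := exists_comul (K := K) a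
  rw [h1, h2, map_sum]
  simp

/-- The span of the right translates of the functions in `s`. -/
def rspan (K : Type*) {A : Type*} [Field K] [CommRing A] [Bialgebra K A] (s : Set A) :
    Submodule K A :=
  Submodule.span K {b | ∃ a ∈ s, ∃ x : Pt K A, b = rtrans x a}

/-- All right translates of `a` are combinations of the finitely many first tensor legs of the
comultiplication of `a`. -/
theorem finite_rspan {s : Set A} (hs : s.Finite) : Module.Finite K (rspan K s) := by
  classical
  choose t ht using fun a : A => exists_comul (K := K) a
  have hf : (⋃ a ∈ s, Prod.fst '' (t a : Set (A × A))).Finite :=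
    hs.biUnion fun a _ => (t a).finite_toSet.image _
  have hle : rspan K s ≤ Submodule.span K (⋃ a ∈ s, Prod.fst '' (t a : Set (A × A))) := by
    refine Submodule.span_le.2 ?_
    rintro _ ⟨a, ha, x, rfl⟩
    rw [(ht a).2.1 x]
    refine Submodule.sum_mem _ fun p hp => Submodule.smul_mem _ _ (Submodule.subset_span ?_)
    exact Set.mem_biUnion ha ⟨p, hp, rfl⟩
  have := FiniteDimensional.span_of_finite K hf
  exact Submodule.finiteDimensional_of_le hle

variable [IsAlgClosed K] [IsDomain A] [Algebra.FiniteType K A]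

theorem rtrans_mul (x y : Pt K A) (a : A) : rtrans (x * y) a = rtrans x (rtrans y a) :=
  eq_of_eval_eq (K := K) fun z => by simp only [eval_rtrans, mul_assoc]

theorem rtrans_one (a : A) : rtrans (1 : Pt K A) a = a :=
  eq_of_eval_eq (K := K) fun z => by simp only [eval_rtrans, mul_one]

theorem subset_rspan (s : Set A) : s ⊆ rspan K s := fun a ha =>
  Submodule.subset_span ⟨a, ha, 1, (rtrans_one a).symm⟩

theorem rtrans_mem_rspan {s : Set A} (x : Pt K A) {a : A} (ha : a ∈ rspan K s) :
    rtrans x a ∈ rspan K s := by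
  induction ha using Submodule.span_induction with
  | mem a ha =>
    obtain ⟨b, hb, y, rfl⟩ := ha
    exact Submodule.subset_span ⟨b, hb, x * y, (rtrans_mul x y b).symm⟩
  | zero => simp
  | add a b _ _ h1 h2 => rw [map_add]; exact add_mem h1 h2
  | smul c a _ h1 => rw [map_smul]; exact Submodule.smul_mem _ _ h1


/-- The representation of the monoid by right translations on the span of the right translates
of the functions in `s`. -/
noncomputable def rrep (s : Set A) : Pt K A →* Module.End K (rspan K s) where
  toFun x := (rtrans x).toLinearMap.restrict fun _ ha => rtrans_mem_rspan x ha
  map_one' := by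
    ext a
    exact rtrans_one (a : A)
  map_mul' x y := by
    ext a
    exact rtrans_mul x y (a : A)

@[simp] theorem coe_rrep (s : Set A) (x : Pt K A) (a : rspan K s) :
    (rrep s x a : A) = rtrans x (a : A) := rfl

/-- A linear functional on operators pulls back to a regular function. -/
theorem exists_matrix_coeff (s : Set A) [Module.Finite K (rspan K s)]
    (l : Module.End K (rspan K s) →ₗ[K] K) : ∃ a : A, ∀ x : Pt K A, x.ofConv a = l (rrep s x) := by
  classical
  let b := Module.finBasis K (rspan K s)
  have hc : ∀ i j, ∃ a : A, ∀ x : Pt K A, x.ofConv a = LinearMap.toMatrix b b (rrep s x) i j := by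
    intro i j
    -- The tensor legs of `b j` need not lie in the span of translates, so the coordinate functional
    -- is extended to all of `A` before it is applied leg by leg.
    obtain ⟨φ, hφ⟩ := LinearMap.exists_extend (b.coord i)
    obtain ⟨t, -, ht, -⟩ := exists_comul (K := K) (b j : A)
    refine ⟨∑ p ∈ t, φ p.1 • p.2, fun x => ?_⟩
    have h1 : LinearMap.toMatrix b b (rrep s x) i j = φ (rtrans x (b j : A)) := by
      rw [LinearMap.toMatrix_apply, ← coe_rrep, ← b.coord_apply, ← hφ]
      rfl
    rw [h1, ht, map_sum, map_sum]
    simp [mul_comm]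
  choose c hc using hc
  refine ⟨∑ i, ∑ j, l (Matrix.toLin b b (Matrix.single i j 1)) • c i j, fun x => ?_⟩
  have h2 : rrep s x = ∑ i, ∑ j, x.ofConv (c i j) • Matrix.toLin b b (Matrix.single i j 1) := by
    conv_lhs => rw [← Matrix.toLin_toMatrix b b (rrep s x),
      Matrix.matrix_eq_sum_single (LinearMap.toMatrix b b (rrep s x))]
    simp only [map_sum, hc]
    refine Finset.sum_congr rfl fun i _ => Finset.sum_congr rfl fun j _ => ?_
    rw [← map_smul, Matrix.smul_single, smul_eq_mul, mul_one]
  conv_rhs => rw [h2]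
  simp [mul_comm]

/-- The determinant of the right translations is a regular function. -/
theorem exists_det_coeff (s : Set A) [Module.Finite K (rspan K s)] :
    ∃ d : A, ∀ x : Pt K A, x.ofConv d = LinearMap.det (rrep s x) := by
  classical
  let b := Module.finBasis K (rspan K s)
  have hc : ∀ i j, ∃ a : A, ∀ x : Pt K A, x.ofConv a = LinearMap.toMatrix b b (rrep s x) i j :=
    fun i j => exists_matrix_coeff s ((Matrix.entryLinearMap K K i j) ∘ₗ
      (LinearMap.toMatrix b b).toLinearMap)
  choose c hc using hc
  refine ⟨Matrix.det (Matrix.of c), fun x => ?_⟩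
  rw [← LinearMap.det_toMatrix b, ← AlgHom.coe_toRingHom, RingHom.map_det]
  congr 1
  ext i j
  simp [← hc]

/-- A finite set of functions that generates the coordinate ring. -/
theorem exists_finite_adjoin (K A : Type*) [Field K] [CommRing A] [Algebra K A]
    [Algebra.FiniteType K A] : ∃ s : Set A, s.Finite ∧ Algebra.adjoin K s = ⊤ := by
  obtain ⟨s, hs⟩ := (inferInstance : Algebra.FiniteType K A).out
  exact ⟨s, s.finite_toSet, hs⟩

/-- Invertibility on a space containing generators makes the translation `rtrans x` surjective,
hence an automorphism of the Noetherian ring `A`. Its inverse followed by evaluation at 1 is the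
inverse point. -/
theorem isUnit_of_det_ne_zero {s : Set A} (hs : Algebra.adjoin K s = ⊤)
    [Module.Finite K (rspan K s)] {x : Pt K A} (hx : LinearMap.det (rrep s x) ≠ 0) :
    IsUnit x := by
  have hsurj : Function.Surjective (rtrans x) := by
    have h1 : Function.Surjective (rrep s x) := by
      have : IsUnit (rrep s x) := (LinearMap.isUnit_iff_isUnit_det _).2 (isUnit_iff_ne_zero.2 hx)
      exact ((Module.End.isUnit_iff _).1 this).2
    rw [← AlgHom.range_eq_top, eq_top_iff, ← hs, Algebra.adjoin_le_iff]
    intro a ha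
    obtain ⟨b, hb⟩ := h1 ⟨a, subset_rspan s ha⟩
    exact ⟨b, by simpa using congrArg Subtype.val hb⟩
  have : IsNoetherianRing A := Algebra.FiniteType.isNoetherianRing K A
  have hinj : Function.Injective (rtrans x) :=
    injective_of_surjective_endomorphism (rtrans x).toRingHom hsurj
  let e : A ≃ₐ[K] A := AlgEquiv.ofBijective (rtrans x) ⟨hinj, hsurj⟩
  let y : Pt K A := WithConv.toConv ((1 : Pt K A).ofConv.comp e.symm.toAlgHom)
  have hyx : y * x = 1 := by
    apply Pt.ext
    intro a
    rw [← eval_rtrans]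
    change (1 : Pt K A).ofConv (e.symm (e a)) = _
    rw [e.symm_apply_apply]
  have hxy : x * y = 1 := by
    have h1 : ∀ a, rtrans (x * y) a = a := fun a => by
      have h2 : rtrans (y * x) a = a := by rw [hyx, rtrans_one]
      obtain ⟨b, rfl⟩ := hsurj a
      rw [rtrans_mul, ← rtrans_mul y x, hyx, rtrans_one]
    apply Pt.ext
    intro a
    rw [← one_mul (x * y), ← eval_rtrans, h1]
  exact ⟨⟨x, y, hxy, hyx⟩, rfl⟩

theorem det_rrep_unit_ne_zero (s : Set A) (g : (Pt K A)ˣ) :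
    LinearMap.det (rrep s (g : Pt K A)) ≠ 0 := by
  have h : IsUnit (rrep s (g : Pt K A)) := g.isUnit.map _
  exact (h.map LinearMap.det).ne_zero

/-- The group of invertible elements is dense. -/
theorem exists_unit_eval_ne_zero {a : A} (ha : a ≠ 0) :
    ∃ g : (Pt K A)ˣ, (g : Pt K A).ofConv a ≠ 0 := by
  obtain ⟨s, hsf, hs⟩ := exists_finite_adjoin K A
  have := finite_rspan (K := K) hsf
  obtain ⟨d, hd⟩ := exists_det_coeff (K := K) s
  -- The determinant is 1 at the unity, so its nonvanishing locus, which consists of units, meets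
  -- that of `a`.
  have hd0 : d ≠ 0 := by
    rintro rfl
    have := hd 1
    simp at this
  obtain ⟨x, hx⟩ := exists_eval_ne_zero (K := K) (mul_ne_zero ha hd0)
  rw [map_mul] at hx
  obtain ⟨g, rfl⟩ := isUnit_of_det_ne_zero hs (x := x) (by rw [← hd]; exact right_ne_zero_of_mul hx)
  exact ⟨g, left_ne_zero_of_mul hx⟩

theorem eq_of_unit_eval_eq {a b : A}
    (h : ∀ g : (Pt K A)ˣ, (g : Pt K A).ofConv a = (g : Pt K A).ofConv b) : a = b := by
  by_contra hab
  obtain ⟨x, hx⟩ := exists_unit_eval_ne_zero (K := K) (sub_ne_zero.2 hab)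
  exact hx (by rw [map_sub, h, sub_self])

/-- Passing to the inverse is a regular map on the group of invertible elements. -/
theorem exists_inv_eval (a : A) : ∃ b d : A, ∀ g : (Pt K A)ˣ, (g : Pt K A).ofConv d ≠ 0 ∧
    ((g⁻¹ : (Pt K A)ˣ) : Pt K A).ofConv a * (g : Pt K A).ofConv d = (g : Pt K A).ofConv b := by
  classical
  have := finite_rspan (K := K) (Set.finite_singleton a)
  obtain ⟨d, hd⟩ := exists_det_coeff (K := K) {a}
  let bs := Module.finBasis K (rspan K {a})
  have hc : ∀ i j, ∃ c : A, ∀ x : Pt K A,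
      x.ofConv c = LinearMap.toMatrix bs bs (rrep {a} x) i j :=
    fun i j => exists_matrix_coeff {a} ((Matrix.entryLinearMap K K i j) ∘ₗ
      (LinearMap.toMatrix bs bs).toLinearMap)
  choose c hc using hc
  let a' : rspan K {a} := ⟨a, subset_rspan _ rfl⟩
  -- Cramer's rule: a(g⁻¹) is the value at 1 of the translate of `a` by g⁻¹, and the matrix of that
  -- translation is the adjugate of the matrix of g divided by its determinant.
  refine ⟨∑ i, (∑ j, Matrix.adjugate (Matrix.of c) i j * algebraMap K A (bs.repr a' j)) *
    algebraMap K A ((1 : Pt K A).ofConv (bs i : A)), d, fun g => ⟨?_, ?_⟩⟩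
  · rw [hd]; exact det_rrep_unit_ne_zero _ g
  · set M := LinearMap.toMatrix bs bs (rrep {a} (g : Pt K A)) with hM
    have hMc : ∀ i j, (g : Pt K A).ofConv (Matrix.adjugate (Matrix.of c) i j) =
        Matrix.adjugate M i j := by
      intro i j
      have h1 : M = (g : Pt K A).ofConv.toRingHom.mapMatrix (Matrix.of c) := by
        ext i j
        simp [hM, ← hc]
      rw [h1, ← RingHom.map_adjugate]
      rfl
    have hdet : (g : Pt K A).ofConv d = M.det := by rw [hd, hM, LinearMap.det_toMatrix]
    have hinv : LinearMap.toMatrix bs bs (rrep {a} ((g⁻¹ : (Pt K A)ˣ) : Pt K A)) * M = 1 := by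
      rw [hM, ← LinearMap.toMatrix_mul, ← map_mul, Units.inv_mul, map_one, LinearMap.toMatrix_one]
    have hadj : M.det • LinearMap.toMatrix bs bs (rrep {a} ((g⁻¹ : (Pt K A)ˣ) : Pt K A)) =
        M.adjugate := by
      have := congrArg (· * M.adjugate) hinv
      simp only [mul_assoc, Matrix.mul_adjugate, one_mul] at this
      simpa using this
    have hv : ((g⁻¹ : (Pt K A)ˣ) : Pt K A).ofConv a =
        ∑ i, (∑ j, LinearMap.toMatrix bs bs (rrep {a} ((g⁻¹ : (Pt K A)ˣ) : Pt K A)) i j *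
          bs.repr a' j) * (1 : Pt K A).ofConv (bs i : A) := by
      have h1 : ((g⁻¹ : (Pt K A)ˣ) : Pt K A).ofConv a =
          (1 : Pt K A).ofConv (rrep {a} ((g⁻¹ : (Pt K A)ˣ) : Pt K A) a' : A) := by
        rw [coe_rrep, eval_rtrans, one_mul]
      rw [h1, ← bs.sum_repr (rrep {a} ((g⁻¹ : (Pt K A)ˣ) : Pt K A) a')]
      simp only [Submodule.coe_sum, map_sum, Submodule.coe_smul, map_smul, smul_eq_mul]
      refine Finset.sum_congr rfl fun i _ => ?_
      rw [← LinearMap.toMatrix_mulVec_repr bs bs]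
      rfl
    rw [hv, hdet, map_sum, Finset.sum_mul]
    refine Finset.sum_congr rfl fun i _ => ?_
    rw [map_mul, map_sum, mul_right_comm, Finset.sum_mul, AlgHom.commutes]
    congr 1
    refine Finset.sum_congr rfl fun j _ => ?_
    rw [map_mul, hMc, ← hadj, AlgHom.commutes]
    simp
    ring

end Translations

end AffineMonoid

namespace AffineMonoid

/-! ### Characters of the torus -/

section Characters

variable {K : Type*} [Field K] {r : ℕ}

/-- The character `t ↦ ∏ t_i ^ m_i` of the torus. -/
def chr (m : Fin r → ℤ) : (Fin r → Kˣ) →* Kˣ where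
  toFun t := ∏ i, t i ^ m i
  map_one' := by simp
  map_mul' s t := by simp [mul_zpow, Finset.prod_mul_distrib]

theorem chr_apply (m : Fin r → ℤ) (t : Fin r → Kˣ) : chr m t = ∏ i, t i ^ m i := rfl

theorem chr_add (m n : Fin r → ℤ) (t : Fin r → Kˣ) : chr (m + n) t = chr m t * chr n t := by
  simp [chr_apply, zpow_add, Finset.prod_mul_distrib]

@[simp] theorem chr_zero (t : Fin r → Kˣ) : chr 0 t = 1 := by simp [chr_apply]

theorem chr_sub (m n : Fin r → ℤ) (t : Fin r → Kˣ) : chr (m - n) t = chr m t / chr n t := by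
  rw [eq_div_iff_mul_eq', ← chr_add, sub_add_cancel]

theorem chr_single (i : Fin r) (n : ℤ) (t : Fin r → Kˣ) : chr (Pi.single i n) t = t i ^ n := by
  rw [chr_apply, Finset.prod_eq_single i]
  · simp
  · intro j _ hj
    simp [Pi.single_eq_of_ne hj]
  · simp

theorem evalLaurent_eq (f : (Fin r → ℤ) →₀ K) (t : Fin r → Kˣ) :
    evalLaurent f t = f.sum fun m c => c * (chr m t : K) := by
  simp [evalLaurent, chr_apply]

theorem two_zpow_injective [CharZero K] {n : ℤ}
    (h : (Units.mk0 (2 : K) two_ne_zero) ^ n = 1) : n = 0 := by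
  have h1 : ((2 : ℚ) : K) ^ n = ((1 : ℚ) : K) := by
    have := congrArg (Units.val) h
    simpa using this
  have h2 : (2 : ℚ) ^ n = 1 := by
    rw [← Rat.cast_zpow] at h1
    exact Rat.cast_injective h1
  exact (zpow_eq_one_iff_right₀ (by norm_num) (by norm_num)).1 h2

theorem chr_injective [CharZero K] {m n : Fin r → ℤ} (h : ∀ t : Fin r → Kˣ, chr m t = chr n t) :
    m = n := by
  rw [← sub_eq_zero]
  funext i
  have h1 : ∀ t : Fin r → Kˣ, chr (m - n) t = 1 := fun t => by rw [chr_sub, h, div_self']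
  have := h1 (Function.update 1 i (Units.mk0 2 two_ne_zero))
  rw [chr_apply, Finset.prod_eq_single i] at this
  · simpa using two_zpow_injective (by simpa using this)
  · intro j _ hj
    simp [Function.update_of_ne hj]
  · simp

theorem chr_coeff_eq_zero [CharZero K] {s : Finset (Fin r → ℤ)} {c : (Fin r → ℤ) → K}
    (h : ∀ t : Fin r → Kˣ, ∑ m ∈ s, (chr m t : K) * c m = 0) : ∀ m ∈ s, c m = 0 := by
  let F : (Fin r → ℤ) → ((Fin r → Kˣ) →* K) := fun m => (Units.coeHom K).comp (chr m)
  have hinj : Function.Injective F := fun m n hmn =>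
    chr_injective fun t => Units.ext (DFunLike.congr_fun hmn t)
  have hli : LinearIndependent K
      ((fun f : (Fin r → Kˣ) →* K => (f : (Fin r → Kˣ) → K)) ∘ F) :=
    (linearIndependent_monoidHom (Fin r → Kˣ) K).comp F hinj
  refine linearIndependent_iff'.1 hli s c ?_
  funext t
  rw [Finset.sum_apply, Pi.zero_apply, ← h t]
  exact Finset.sum_congr rfl fun m _ => mul_comm _ _

theorem chr_coeff_eq [CharZero K] {s : Finset (Fin r → ℤ)} {c d : (Fin r → ℤ) → K}
    (h : ∀ t : Fin r → Kˣ, ∑ m ∈ s, (chr m t : K) * c m = ∑ m ∈ s, (chr m t : K) * d m) :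
    ∀ m ∈ s, c m = d m := by
  intro m hm
  refine sub_eq_zero.1 (chr_coeff_eq_zero (s := s) (c := fun m => c m - d m) (fun t => ?_) m hm)
  simp [mul_sub, Finset.sum_sub_distrib, h t]

/-- Laurent polynomial functions on the torus have no zero divisors. -/
theorem laurent_mul_eq_zero [CharZero K] {f g : (Fin r → ℤ) →₀ K}
    (h : ∀ t, evalLaurent f t * evalLaurent g t = 0) :
    (∀ t, evalLaurent f t = 0) ∨ ∀ t, evalLaurent g t = 0 := by
  let X : Multiplicative (Fin r → ℤ) →* ((Fin r → Kˣ) → K) :=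
    { toFun := fun m t => (chr m.toAdd t : K)
      map_one' := by ext t; simp
      map_mul' := fun m n => by ext t; simp [chr_add] }
  -- Independence of characters makes this map from the group algebra of ℤ^r to functions injective,
  -- and that group algebra is a domain.
  let E := AddMonoidAlgebra.lift K ((Fin r → Kˣ) → K) (Fin r → ℤ) X
  have hE : ∀ (f : (Fin r → ℤ) →₀ K) t, E (AddMonoidAlgebra.ofCoeff f) t = evalLaurent f t := by
    intro f t
    rw [evalLaurent_eq, AddMonoidAlgebra.lift_apply, Finsupp.sum_apply']
    rfl
  have hinj : ∀ f : AddMonoidAlgebra K (Fin r → ℤ), E f = 0 → f = 0 := by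
    intro f hf
    have h1 := chr_coeff_eq_zero (K := K) (s := f.coeff.support) (c := f.coeff) (fun t => by
      have := congrFun hf t
      rw [show f = AddMonoidAlgebra.ofCoeff f.coeff from rfl, hE, evalLaurent_eq] at this
      rw [← show _ = (0 : K) from this, Finsupp.sum]
      exact Finset.sum_congr rfl fun _ _ => mul_comm _ _)
    have h2 : f.coeff = 0 := by
      ext m
      by_cases hm : m ∈ f.coeff.support
      · exact h1 m hm
      · simpa using hm
    rw [show f = AddMonoidAlgebra.ofCoeff f.coeff from rfl, h2]
    rfl
  have hmul : E (AddMonoidAlgebra.ofCoeff f * AddMonoidAlgebra.ofCoeff g) = 0 := by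
    rw [map_mul]
    funext t
    simpa [hE] using h t
  rcases mul_eq_zero.1 (hinj _ hmul) with h | h
  · left
    intro t
    rw [← hE, h]; simp
  · right
    intro t
    rw [← hE, h]; simp

/-- A partial assignment of values to characters that is multiplicative and consistent is realized
by a point of the torus. -/
theorem exists_torus_point [IsAlgClosed K] (S : AddSubgroup ((Fin r → ℤ) × Additive Kˣ))
    (hS : ∀ u, ((0, u) : (Fin r → ℤ) × Additive Kˣ) ∈ S → u = 0) :
    ∃ t : Fin r → Kˣ, ∀ m u, (m, u) ∈ S → chr m t = u.toMul := by
  classical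
  -- Roots exist because `K` is algebraically closed, so the multiplicative group is divisible, i.e.
  -- injective over ℤ.
  have hroot : ∀ (n : ℤ), n ≠ 0 → ∀ u : Additive Kˣ, ∃ v : Additive Kˣ, n • v = u := by
    have hnat : ∀ (n : ℕ), n ≠ 0 → ∀ u : Additive Kˣ, ∃ v : Additive Kˣ, n • v = u := by
      intro n hn u
      obtain ⟨z, hz⟩ := IsAlgClosed.exists_pow_nat_eq (u.toMul : K) (Nat.pos_of_ne_zero hn)
      have hz0 : z ≠ 0 := by
        rintro rfl
        rw [zero_pow hn] at hz
        exact u.toMul.ne_zero hz.symm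
      refine ⟨Additive.ofMul (Units.mk0 z hz0), ?_⟩
      apply Additive.toMul.injective
      apply Units.ext
      simpa using hz
    intro n hn u
    obtain ⟨v, hv⟩ := hnat n.natAbs (Int.natAbs_ne_zero.2 hn) u
    rcases Int.natAbs_eq n with h | h
    · exact ⟨v, by rw [h, natCast_zsmul, hv]⟩
    · exact ⟨-v, by rw [h, neg_smul, smul_neg, neg_neg, natCast_zsmul, hv]⟩
  let : DivisibleBy (Additive Kˣ) ℤ :=
    { div := fun u n => if h : n = 0 then 0 else (hroot n h u).choose
      div_zero := fun u => by simp
      div_cancel := fun {n} u hn => by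
        simp only [hn, dif_neg, not_false_eq_true]
        exact (hroot n hn u).choose_spec }
  let p : S →+ (Fin r → ℤ) := (AddMonoidHom.fst _ _).comp S.subtype
  have hp : Function.Injective p := by
    rw [injective_iff_map_eq_zero]
    rintro ⟨⟨m, u⟩, hmu⟩ hm
    change m = 0 at hm
    subst hm
    have := hS u hmu
    subst this
    rfl
  -- `S` is the graph of a homomorphism on a subgroup of ℤ^r. Its extension to ℤ^r gives the
  -- coordinates of `t` as the images of the standard basis.
  obtain ⟨h, hh⟩ := (Module.Baer.of_divisible (Additive Kˣ)).extension_property_addMonoidHom p hp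
    ((AddMonoidHom.snd _ _).comp S.subtype)
  refine ⟨fun i => (h (Pi.single i 1)).toMul, fun m u hmu => ?_⟩
  have h1 : h m = u := DFunLike.congr_fun hh ⟨(m, u), hmu⟩
  rw [← h1, chr_apply]
  conv_rhs => rw [← Finset.univ_sum_single m]
  rw [map_sum, toMul_sum]
  refine Finset.prod_congr rfl fun i _ => ?_
  rw [← toMul_zsmul, ← map_zsmul, ← Pi.single_smul]
  simp

end Characters

/-! ### Irreducible sets of points -/

section Irreducible

variable {K A : Type*} [Field K] [CommRing A] [Bialgebra K A]

/-- The ideal of functions vanishing on `S` is prime. -/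
def Irr (S : Set (Pt K A)) : Prop :=
  S.Nonempty ∧ ∀ a b : A, (∀ x ∈ S, x.ofConv a * x.ofConv b = 0) →
    (∀ x ∈ S, x.ofConv a = 0) ∨ ∀ x ∈ S, x.ofConv b = 0

-- If `a` is nonzero at x * y and `b` at x' * y', irreducibility of `S'` moves y and y' to a common
-- z, and irreducibility of `S`, applied to the right translates by z, gives a contradiction.
open Pointwise in
theorem Irr.mul {S S' : Set (Pt K A)} (h : Irr S) (h' : Irr S') : Irr (S * S') := by
  refine ⟨h.1.mul h'.1, fun a b hab => ?_⟩
  by_contra! hne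
  obtain ⟨⟨_, ⟨x, hx, y, hy, rfl⟩, ha⟩, ⟨_, ⟨x', hx', y', hy', rfl⟩, hb⟩⟩ := hne
  have h1 : ∃ z ∈ S', (x * z).ofConv a ≠ 0 ∧ (x' * z).ofConv b ≠ 0 := by
    by_contra! hz
    rcases h'.2 (ltrans x a) (ltrans x' b) (fun z hz' => by
      rw [eval_ltrans, eval_ltrans]
      by_cases h0 : (x * z).ofConv a = 0
      · rw [h0, zero_mul]
      · rw [hz z hz' h0, mul_zero]) with h | h
    · exact ha (by rw [← eval_ltrans]; exact h y hy)
    · exact hb (by rw [← eval_ltrans]; exact h y' hy')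
  obtain ⟨z, hz, h1, h2⟩ := h1
  rcases h.2 (rtrans z a) (rtrans z b) (fun w hw => by
    rw [eval_rtrans, eval_rtrans]
    exact hab _ (Set.mul_mem_mul hw hz)) with h | h
  · exact h1 (by rw [← eval_rtrans]; exact h x hx)
  · exact h2 (by rw [← eval_rtrans]; exact h x' hx')

/-- The prime ideal of functions vanishing on an irreducible set. -/
theorem Irr.isPrime {S : Set (Pt K A)} (h : Irr S) : (vanishingIdeal S).IsPrime := by
  have hm : ∀ a, a ∈ vanishingIdeal S ↔ ∀ x ∈ S, x.ofConv a = 0 := fun a => by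
    simp [vanishingIdeal, RingHom.mem_ker]
  refine ⟨?_, fun {a b} hab => ?_⟩
  · rw [Ideal.ne_top_iff_one, hm]
    obtain ⟨x, hx⟩ := h.1
    exact fun h1 => by simpa using h1 x hx
  · rw [hm, hm]
    exact h.2 a b fun x hx => by rw [← map_mul]; exact (hm _).1 hab x hx

theorem mem_vanishingIdeal {S : Set (Pt K A)} {a : A} :
    a ∈ vanishingIdeal S ↔ ∀ x ∈ S, x.ofConv a = 0 := by
  simp [vanishingIdeal, RingHom.mem_ker]

variable [IsAlgClosed K] [IsDomain A] [Algebra.FiniteType K A]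

/-- A regular function pulled back along g ↦ g x g⁻¹ is a fraction c/d with d nowhere zero on units.
A product vanishing on the class gives c c' = 0 on the dense set of units, and `A` is a domain. -/
theorem irr_conjClass (x : Pt K A) : Irr (conjClass x) := by
  refine ⟨⟨x, 1, by simp⟩, fun a b hab => ?_⟩
  have key : ∀ a : A, ∃ c d : A, ∀ g : (Pt K A)ˣ, (g : Pt K A).ofConv d ≠ 0 ∧
      ((g : Pt K A) * x * ((g⁻¹ : (Pt K A)ˣ) : Pt K A)).ofConv a * (g : Pt K A).ofConv d =
        (g : Pt K A).ofConv c := by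
    classical
    intro a
    obtain ⟨s, hs, -, -⟩ := exists_comul (K := K) a
    choose n d hnd using fun a : A => exists_inv_eval (K := K) a
    refine ⟨∑ p ∈ s, rtrans x p.1 * (n p.2 * ∏ q ∈ s.erase p, d q.2), ∏ q ∈ s, d q.2,
      fun g => ⟨?_, ?_⟩⟩
    · rw [map_prod]
      exact Finset.prod_ne_zero_iff.2 fun q _ => (hnd q.2 g).1
    · rw [hs, map_sum, Finset.sum_mul]
      refine Finset.sum_congr rfl fun p hp => ?_
      rw [map_mul, eval_rtrans, map_mul, ← (hnd p.2 g).2, ← Finset.mul_prod_erase s _ hp, map_mul]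
      ring
  obtain ⟨c, d, hcd⟩ := key a
  obtain ⟨c', d', hcd'⟩ := key b
  have h0 : c * c' = 0 := by
    refine eq_of_unit_eval_eq (K := K) fun g => ?_
    rw [map_mul, ← (hcd g).2, ← (hcd' g).2, map_zero, mul_mul_mul_comm, hab _ ⟨g, rfl⟩, zero_mul]
  rcases mul_eq_zero.1 h0 with h | h
  · left
    rintro _ ⟨g, rfl⟩
    have := (hcd g).2
    rw [h, map_zero] at this
    exact (mul_eq_zero.1 this).resolve_right (hcd g).1
  · right
    rintro _ ⟨g, rfl⟩
    have := (hcd' g).2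
    rw [h, map_zero] at this
    exact (mul_eq_zero.1 this).resolve_right (hcd' g).1

end Irreducible

end AffineMonoid

namespace AffineMonoid

/-! ### Weight spaces for left and right translations by the torus -/

section Weights

variable {K A : Type*} [Field K] [CommRing A] [Bialgebra K A] {r : ℕ}

/-- The group homomorphism `φ` from the torus is a morphism of varieties. -/
def IsRegularHom (φ : (Fin r → Kˣ) →* (Pt K A)ˣ) : Prop :=
  ∀ a : A, ∃ f : (Fin r → ℤ) →₀ K, ∀ t, (φ t : Pt K A).ofConv a = evalLaurent f t

/-- Functions of weight `l` under left translations by the torus. -/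
def leftWeight (φ : (Fin r → Kˣ) →* (Pt K A)ˣ) (l : Fin r → ℤ) : Submodule K A where
  carrier := {a | ∀ t (x : Pt K A), (φ t * x).ofConv a = chr l t * x.ofConv a}
  add_mem' ha hb t x := by rw [map_add, map_add, ha, hb, mul_add]
  zero_mem' t x := by simp
  smul_mem' c a ha t x := by
    rw [map_smul, map_smul, ha, smul_eq_mul, smul_eq_mul]
    ring

/-- Functions of weight `m` under right translations by the torus. -/
def rightWeight (φ : (Fin r → Kˣ) →* (Pt K A)ˣ) (m : Fin r → ℤ) : Submodule K A where
  carrier := {a | ∀ t (x : Pt K A), (x * φ t).ofConv a = chr m t * x.ofConv a}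
  add_mem' ha hb t x := by rw [map_add, map_add, ha, hb, mul_add]
  zero_mem' t x := by simp
  smul_mem' c a ha t x := by
    rw [map_smul, map_smul, ha, smul_eq_mul, smul_eq_mul]
    ring

/-- Functions of left weight `l` and right weight `m`. -/
def weightSpace (φ : (Fin r → Kˣ) →* (Pt K A)ˣ) (l m : Fin r → ℤ) : Submodule K A :=
  leftWeight φ l ⊓ rightWeight φ m

variable {φ : (Fin r → Kˣ) →* (Pt K A)ˣ}

theorem mul_mem_leftWeight {l l' : Fin r → ℤ} {a b : A} (ha : a ∈ leftWeight φ l)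
    (hb : b ∈ leftWeight φ l') : a * b ∈ leftWeight φ (l + l') := fun t x => by
  rw [map_mul, map_mul, ha, hb, chr_add, Units.val_mul]
  ring

theorem mul_mem_rightWeight {l l' : Fin r → ℤ} {a b : A} (ha : a ∈ rightWeight φ l)
    (hb : b ∈ rightWeight φ l') : a * b ∈ rightWeight φ (l + l') := fun t x => by
  rw [map_mul, map_mul, ha, hb, chr_add, Units.val_mul]
  ring

theorem mul_mem_weightSpace {l m l' m' : Fin r → ℤ} {a b : A} (ha : a ∈ weightSpace φ l m)
    (hb : b ∈ weightSpace φ l' m') : a * b ∈ weightSpace φ (l + l') (m + m') :=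
  ⟨mul_mem_leftWeight ha.1 hb.1, mul_mem_rightWeight ha.2 hb.2⟩

theorem one_mem_weightSpace : (1 : A) ∈ weightSpace φ 0 0 :=
  ⟨fun t x => by simp, fun t x => by simp⟩

theorem pow_mem_weightSpace {l m : Fin r → ℤ} {a : A} (ha : a ∈ weightSpace φ l m) (n : ℕ) :
    a ^ n ∈ weightSpace φ (n • l) (n • m) := by
  induction n with
  | zero => simpa using one_mem_weightSpace
  | succ n ih => rw [pow_succ, succ_nsmul, succ_nsmul]; exact mul_mem_weightSpace ih ha

/-- The expansion of a left translate along the torus into weight vectors. -/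
theorem exists_left_expansion (hφ : IsRegularHom φ) (a : A) :
    ∃ (s : Finset (Fin r → ℤ)) (c : (Fin r → ℤ) → A), (∀ m, m ∉ s → c m = 0) ∧
      ∀ t (x : Pt K A), (φ t * x).ofConv a = ∑ m ∈ s, chr m t * x.ofConv (c m) := by
  classical
  obtain ⟨s0, hs0, -, -⟩ := exists_comul (K := K) a
  choose f hf using hφ
  let s := s0.biUnion fun p => (f p.1).support
  refine ⟨s, fun m => ∑ p ∈ s0, f p.1 m • p.2, fun m hm => ?_, fun t x => ?_⟩
  · refine Finset.sum_eq_zero fun p hp => ?_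
    have : f p.1 m = 0 := by
      by_contra h
      exact hm (Finset.mem_biUnion.2 ⟨p, hp, Finsupp.mem_support_iff.2 h⟩)
    rw [this, zero_smul]
  · rw [hs0]
    simp only [map_sum, Finset.mul_sum]
    rw [Finset.sum_comm]
    refine Finset.sum_congr rfl fun p hp => ?_
    rw [hf, evalLaurent_eq, Finsupp.sum_of_support_subset (s := s) _
      (Finset.subset_biUnion_of_mem (fun p : A × A => (f p.1).support) hp) _ (by simp),
      Finset.sum_mul]
    refine Finset.sum_congr rfl fun m _ => ?_
    rw [map_smul, smul_eq_mul]
    ring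

variable [CharZero K]

/-- The expansion of `f (x * t * y)` into characters of `t` in the torus. -/
theorem exists_middle_expansion (hφ : IsRegularHom φ) (f : A) :
    ∃ (s : Finset (Fin r → ℤ)) (F : (Fin r → ℤ) → Pt K A → Pt K A → K),
      (∀ n, n ∉ s → ∀ x y, F n x y = 0) ∧
      (∀ (x : Pt K A) t (y : Pt K A), (x * φ t * y).ofConv f = ∑ n ∈ s, chr n t * F n x y) ∧
      (∀ n y, ∃ a ∈ rightWeight φ n, (∀ l, f ∈ leftWeight φ l → a ∈ leftWeight φ l) ∧
        ∀ x : Pt K A, x.ofConv a = F n x y) ∧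
      ∀ n x, ∃ a ∈ leftWeight φ n, (∀ m, f ∈ rightWeight φ m → a ∈ rightWeight φ m) ∧
        ∀ y : Pt K A, y.ofConv a = F n x y := by
  classical
  obtain ⟨s0, hs0, -, -⟩ := exists_comul (K := K) f
  choose S c hc0 hc using exists_left_expansion hφ
  let s := s0.biUnion fun p => S p.2
  let F : (Fin r → ℤ) → Pt K A → Pt K A → K :=
    fun n x y => ∑ p ∈ s0, x.ofConv p.1 * y.ofConv (c p.2 n)
  have hF : ∀ (x : Pt K A) t (y : Pt K A), (x * φ t * y).ofConv f = ∑ n ∈ s, chr n t * F n x y := by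
    intro x t y
    rw [mul_assoc, hs0]
    simp only [F, Finset.mul_sum]
    rw [Finset.sum_comm]
    refine Finset.sum_congr rfl fun p hp => ?_
    rw [hc, Finset.mul_sum]
    rw [Finset.sum_subset (Finset.subset_biUnion_of_mem (fun p : A × A => S p.2) hp)]
    · exact Finset.sum_congr rfl fun m _ => by ring
    · intro m _ hm
      rw [hc0 _ _ hm, map_zero, mul_zero, mul_zero]
  have hF0 : ∀ n, n ∉ s → ∀ x y, F n x y = 0 := by
    intro n hn x y
    refine Finset.sum_eq_zero fun p hp => ?_
    rw [hc0, map_zero, mul_zero]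
    exact fun h => hn (Finset.mem_biUnion.2 ⟨p, hp, h⟩)
  have ext : ∀ {G H : (Fin r → ℤ) → K}, (∀ n, n ∉ s → G n = H n) →
      (∀ t : Fin r → Kˣ, ∑ n ∈ s, (chr n t : K) * G n = ∑ n ∈ s, (chr n t : K) * H n) → ∀ n, G n = H n := by
    intro G H h0 h n
    by_cases hn : n ∈ s
    · exact chr_coeff_eq h n hn
    · exact h0 n hn
  -- By independence of characters, the coefficients of both sides in f(x φ(u) φ(t) y) can be
  -- compared.
  have h1 : ∀ u x y n, F n (x * φ u) y = (chr n u : K) * F n x y := fun u x y => by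
    refine ext (fun n hn => by rw [hF0 n hn, hF0 n hn, mul_zero]) fun t => ?_
    rw [← hF, mul_assoc x, ← Units.val_mul, ← map_mul, hF]
    exact Finset.sum_congr rfl fun n _ => by rw [map_mul, Units.val_mul]; ring
  have h2 : ∀ u x y n, F n x (φ u * y) = (chr n u : K) * F n x y := fun u x y => by
    refine ext (fun n hn => by rw [hF0 n hn, hF0 n hn, mul_zero]) fun t => ?_
    rw [← hF, mul_assoc x, ← mul_assoc (φ t : Pt K A), ← Units.val_mul, ← map_mul, ← mul_assoc, hF]
    exact Finset.sum_congr rfl fun n _ => by rw [map_mul, Units.val_mul]; ring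
  refine ⟨s, F, hF0, hF, fun n y => ?_, fun n x => ?_⟩
  · have hev : ∀ x : Pt K A, x.ofConv (∑ p ∈ s0, y.ofConv (c p.2 n) • p.1) = F n x y := by
      intro x
      simp [F, mul_comm]
    refine ⟨_, fun t x => ?_, fun l hl t x => ?_, hev⟩
    · rw [hev, hev, h1]
    · rw [hev, hev]
      revert n
      refine fun n _ => ext (G := fun n => F n (φ t * x) y) (H := fun n => (chr l t : K) * F n x y)
        (fun n hn => by rw [hF0 n hn, hF0 n hn, mul_zero]) (fun u => ?_) n
      rw [← hF, mul_assoc, mul_assoc, hl, ← mul_assoc, hF, Finset.mul_sum]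
      exact Finset.sum_congr rfl fun n _ => by ring
  · have hev : ∀ y : Pt K A, y.ofConv (∑ p ∈ s0, x.ofConv p.1 • c p.2 n) = F n x y := by
      intro y
      simp [F]
    refine ⟨_, fun t y => ?_, fun m hm t y => ?_, hev⟩
    · rw [hev, hev, h2]
    · rw [hev, hev]
      revert n
      refine fun n _ => ext (G := fun n => F n x (y * φ t)) (H := fun n => (chr m t : K) * F n x y)
        (fun n hn => by rw [hF0 n hn, hF0 n hn, mul_zero]) (fun u => ?_) n
      rw [← hF, ← mul_assoc, hm, hF, Finset.mul_sum]
      exact Finset.sum_congr rfl fun n _ => by ring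

/-- Left and right translation of the unity by φ(t) agree, so a nonzero value there would force
equal characters. -/
theorem eval_one_eq_zero {l m : Fin r → ℤ} (hlm : l ≠ m) {f : A} (hf : f ∈ weightSpace φ l m) :
    (1 : Pt K A).ofConv f = 0 := by
  by_contra h0
  refine hlm (chr_injective (K := K) fun t => Units.ext ?_)
  have h1 := hf.1 t 1
  have h2 := hf.2 t 1
  rw [mul_one] at h1
  rw [one_mul, h1] at h2
  exact mul_right_cancel₀ h0 h2

/-- The expansion of a weight vector along the comultiplication. -/
theorem exists_weight_expansion (hφ : IsRegularHom φ) {l m : Fin r → ℤ} {f : A}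
    (hf : f ∈ weightSpace φ l m) :
    ∃ (s : Finset (Fin r → ℤ)) (F : (Fin r → ℤ) → Pt K A → Pt K A → K),
      (∀ n, n ∉ s → ∀ x y, F n x y = 0) ∧
      (∀ x y : Pt K A, (x * y).ofConv f = ∑ n ∈ s, F n x y) ∧
      (∀ n y, ∃ a ∈ weightSpace φ l n, ∀ x : Pt K A, x.ofConv a = F n x y) ∧
      ∀ n x, ∃ a ∈ weightSpace φ n m, ∀ y : Pt K A, y.ofConv a = F n x y := by
  obtain ⟨s, F, hF0, hF, h1, h2⟩ := exists_middle_expansion hφ f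
  refine ⟨s, F, hF0, fun x y => ?_, fun n y => ?_, fun n x => ?_⟩
  · simpa using hF x 1 y
  · obtain ⟨a, ha, hl, hx⟩ := h1 n y
    exact ⟨a, ⟨hl l hf.1, ha⟩, hx⟩
  · obtain ⟨a, ha, hl, hx⟩ := h2 n x
    exact ⟨a, ⟨ha, hl m hf.2⟩, hx⟩

variable [IsAlgClosed K] [IsDomain A] [Algebra.FiniteType K A]

/-- The weight spaces span the coordinate ring. -/
theorem span_weightSpace (hφ : IsRegularHom φ) :
    Submodule.span K {a : A | ∃ l m, a ∈ weightSpace φ l m} = ⊤ := by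
  -- The middle expansion at y = t = 1 splits a function into right weight vectors; at x = t = 1 it
  -- splits each of these by left weight.
  have hleft : ∀ a : A, ∀ m, a ∈ rightWeight φ m →
      a ∈ Submodule.span K {a : A | ∃ l m, a ∈ weightSpace φ l m} := by
    intro a m ha
    obtain ⟨s, F, -, hF, -, h2⟩ := exists_middle_expansion hφ a
    choose c hc1 hc2 hc3 using h2
    have : a = ∑ n ∈ s, c n 1 := by
      refine eq_of_eval_eq (K := K) fun x => ?_
      have := hF 1 1 x
      simp only [map_one, Units.val_one, one_mul] at this
      rw [this, map_sum]
      exact Finset.sum_congr rfl fun n _ => (hc3 n 1 x).symm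
    rw [this]
    exact Submodule.sum_mem _ fun n _ => Submodule.subset_span ⟨n, m, hc1 n 1, hc2 n 1 m ha⟩
  rw [eq_top_iff]
  intro a _
  obtain ⟨s, F, -, hF, h1, -⟩ := exists_middle_expansion hφ a
  choose c hc1 hc2 hc3 using h1
  have : a = ∑ n ∈ s, c n 1 := by
    refine eq_of_eval_eq (K := K) fun x => ?_
    have := hF x 1 1
    simp only [map_one, Units.val_one, one_mul, mul_one] at this
    rw [this, map_sum]
    exact Finset.sum_congr rfl fun n _ => (hc3 n 1 x).symm
  rw [this]
  exact Submodule.sum_mem _ fun n _ => hleft _ n (hc1 n 1)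

/-- Expand f(1 * y) where f(y) ≠ 0: some term is nonzero, so a function of weight (l, n) is nonzero
at 1, which forces n = l. -/
theorem exists_diag_left (hφ : IsRegularHom φ) {l m : Fin r → ℤ} {f : A}
    (hf : f ∈ weightSpace φ l m) (hf0 : f ≠ 0) :
    ∃ h ∈ weightSpace φ l l, (1 : Pt K A).ofConv h = 1 := by
  obtain ⟨s, F, -, hF, h1, -⟩ := exists_weight_expansion hφ hf
  obtain ⟨y, hy⟩ := exists_eval_ne_zero (K := K) hf0
  rw [← one_mul y, hF] at hy
  obtain ⟨n, -, hn⟩ := Finset.exists_ne_zero_of_sum_ne_zero hy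
  obtain ⟨a, ha, hx⟩ := h1 n y
  rw [← hx] at hn
  have : l = n := by
    by_contra h
    exact hn (eval_one_eq_zero h ha)
  subst this
  exact ⟨((1 : Pt K A).ofConv a)⁻¹ • a, Submodule.smul_mem _ _ ha, by
    rw [map_smul, smul_eq_mul, inv_mul_cancel₀ hn]⟩

theorem exists_diag_right (hφ : IsRegularHom φ) {l m : Fin r → ℤ} {f : A}
    (hf : f ∈ weightSpace φ l m) (hf0 : f ≠ 0) :
    ∃ h ∈ weightSpace φ m m, (1 : Pt K A).ofConv h = 1 := by
  obtain ⟨s, F, -, hF, -, h1⟩ := exists_weight_expansion hφ hf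
  obtain ⟨y, hy⟩ := exists_eval_ne_zero (K := K) hf0
  rw [← mul_one y, hF] at hy
  obtain ⟨n, -, hn⟩ := Finset.exists_ne_zero_of_sum_ne_zero hy
  obtain ⟨a, ha, hx⟩ := h1 n y
  rw [← hx] at hn
  have : n = m := by
    by_contra h
    exact hn (eval_one_eq_zero h ha)
  subst this
  exact ⟨((1 : Pt K A).ofConv a)⁻¹ • a, Submodule.smul_mem _ _ ha, by
    rw [map_smul, smul_eq_mul, inv_mul_cancel₀ hn]⟩

end Weights

end AffineMonoid

namespace AffineMonoid

/-! ### The dimension argument -/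

section Dimension

open Pointwise

variable {K A : Type*} [Field K] [CommRing A] [Bialgebra K A] {r : ℕ}
  {φ : (Fin r → Kˣ) →* (Pt K A)ˣ}

/-- The endomorphism of the torus given by an endomorphism of the character lattice. -/
def IsMonomialHom (ψ : (Fin r → Kˣ) →* (Fin r → Kˣ)) : Prop :=
  ∀ m, ∃ m', ∀ t, chr m (ψ t) = chr m' t

theorem irr_singleton (x : Pt K A) : Irr {x} := by
  refine ⟨⟨x, rfl⟩, fun a b h => ?_⟩
  simpa using h

/-- Pullbacks to the torus are Laurent polynomials, which have no zero divisors. The monomial map ψ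
covers both the truncated tori and the one-parameter subgroups needed later. -/
theorem irr_torus [CharZero K] (hφ : IsRegularHom φ) {ψ : (Fin r → Kˣ) →* (Fin r → Kˣ)}
    (hψ : IsMonomialHom ψ) : Irr (Set.range fun t => (φ (ψ t) : Pt K A)) := by
  refine ⟨⟨_, 1, rfl⟩, fun a b hab => ?_⟩
  choose p hp using hψ
  have key : ∀ a : A, ∃ f : (Fin r → ℤ) →₀ K, ∀ t,
      (φ (ψ t) : Pt K A).ofConv a = evalLaurent f t := by
    intro a
    obtain ⟨f, hf⟩ := hφ a
    refine ⟨f.mapDomain p, fun t => ?_⟩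
    rw [hf, evalLaurent_eq, evalLaurent_eq, Finsupp.sum_mapDomain_index (by simp)
      (fun _ _ _ => by ring)]
    simp only [hp]
  obtain ⟨f, hf⟩ := key a
  obtain ⟨g, hg⟩ := key b
  rcases laurent_mul_eq_zero (f := f) (g := g) (fun t => by
    rw [← hf, ← hg]; exact hab _ ⟨t, rfl⟩) with h | h
  · left
    rintro _ ⟨t, rfl⟩
    simp [hf, h]
  · right
    rintro _ ⟨t, rfl⟩
    simp [hg, h]

/-- The projection of the torus that replaces the first `j` coordinates by `1`. -/
def truncate (K : Type*) [Field K] (r j : ℕ) : (Fin r → Kˣ) →* (Fin r → Kˣ) where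
  toFun t i := if (i : ℕ) < j then 1 else t i
  map_one' := by ext i; simp
  map_mul' s t := by
    ext i
    by_cases h : (i : ℕ) < j <;> simp [h]

theorem chr_truncate (j : ℕ) (m : Fin r → ℤ) (t : Fin r → Kˣ) :
    chr m (truncate K r j t) = chr (fun i => if (i : ℕ) < j then 0 else m i) t := by
  rw [chr_apply, chr_apply]
  refine Finset.prod_congr rfl fun i _ => ?_
  by_cases h : (i : ℕ) < j <;> simp [h, truncate]

theorem truncate_isMonomialHom (j : ℕ) : IsMonomialHom (truncate K r j) :=
  fun m => ⟨_, chr_truncate j m⟩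

variable [CharZero K] [IsAlgClosed K] [IsDomain A] [Algebra.FiniteType K A]

/-- The set of characters of the torus that extend to regular functions. -/
def IsRegularChr (φ : (Fin r → Kˣ) →* (Pt K A)ˣ) (m : Fin r → ℤ) : Prop :=
  ∃ h : A, ∀ t, (φ t : Pt K A).ofConv h = chr m t

/-- The characters of the torus that extend to regular functions separate the subtori. -/
theorem exists_eval_truncate_ne_zero (hφ : IsRegularHom φ) (hinj : Function.Injective φ)
    {j : ℕ} (hj : j < r) : ∃ a : A, (∀ t, (φ (truncate K r (j + 1) t) : Pt K A).ofConv a = 0) ∧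
      ∃ t, (φ (truncate K r j t) : Pt K A).ofConv a ≠ 0 := by
  classical
  by_contra! H
  let two : Additive Kˣ := Additive.ofMul (Units.mk0 2 two_ne_zero)
  -- Prescribe the value 1 on characters that extend to regular functions and the value 2 on the
  -- coordinate `j`; 2 has infinite order in characteristic zero.
  let S : AddSubgroup ((Fin r → ℤ) × Additive Kˣ) :=
    { carrier := {p | ∃ m m' n, IsRegularChr φ m ∧ IsRegularChr φ m' ∧
        p.1 + m' = m + Pi.single (⟨j, hj⟩ : Fin r) n ∧ p.2 = n • two}
      zero_mem' := ⟨0, 0, 0, ⟨1, by simp⟩, ⟨1, by simp⟩, by simp, by simp⟩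
      add_mem' := by
        rintro p q ⟨m, m', n, ⟨h1, hh1⟩, ⟨h2, hh2⟩, h3, h4⟩
          ⟨k, k', l, ⟨g1, hg1⟩, ⟨g2, hg2⟩, g3, g4⟩
        refine ⟨m + k, m' + k', n + l, ⟨h1 * g1, fun t => ?_⟩, ⟨h2 * g2, fun t => ?_⟩, ?_, ?_⟩
        · rw [map_mul, hh1, hg1, chr_add, Units.val_mul]
        · rw [map_mul, hh2, hg2, chr_add, Units.val_mul]
        · rw [Prod.fst_add, add_add_add_comm, h3, g3, Pi.single_add]
          abel
        · rw [Prod.snd_add, h4, g4, add_zsmul]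
      neg_mem' := by
        rintro p ⟨m, m', n, h1, h2, h3, h4⟩
        refine ⟨m', m, -n, h2, h1, ?_, ?_⟩
        · rw [Prod.fst_neg, Pi.single_neg, neg_add_eq_iff_eq_add, ← add_assoc, h3]
          abel
        · rw [Prod.snd_neg, h4, neg_smul] }
  obtain ⟨t, ht⟩ := exists_torus_point S (by
    rintro u ⟨m, m', n, ⟨h1, hh1⟩, ⟨h2, hh2⟩, h3, h4⟩
    simp only [zero_add] at h3 h4
    -- Regular characters that differ by a power of the coordinate `j` agree on the smaller
    -- subtorus, where that coordinate is 1, hence by `H` on the larger one.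
    have h5 : ∀ t, (chr m' (truncate K r j t) : K) = chr m (truncate K r j t) := by
      intro t
      rw [← sub_eq_zero, ← hh1, ← hh2, ← map_sub]
      refine H (h2 - h1) (fun t => ?_) t
      rw [map_sub, hh1, hh2, h3, chr_add, chr_single]
      simp [truncate]
    have h6 : n = 0 := by
      refine two_zpow_injective (K := K) ?_
      have := h5 (Function.update 1 ⟨j, hj⟩ (Units.mk0 2 two_ne_zero))
      rw [h3, chr_add, chr_single, Units.val_mul] at this
      have h7 := mul_left_cancel₀ (Units.ne_zero _) (this.trans (mul_one _).symm)
      apply Units.ext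
      simpa [truncate] using h7
    rw [h4, h6, zero_smul])
  -- The left weight of a weight vector nonzero at 1 is a regular character, on which `t` is
  -- trivial; so φ(t) and 1 agree on all weight vectors. But the coordinate `j` of `t` is 2.
  have ht1 : t = 1 := by
    apply hinj
    apply Units.ext
    rw [map_one, Units.val_one]
    refine Pt.ext_of_span (span_weightSpace hφ) ?_
    rintro a ⟨l, m, ha⟩
    have h1 : ∀ t, (φ t : Pt K A).ofConv a = chr l t * (1 : Pt K A).ofConv a := fun t => by
      have := ha.1 t 1
      rwa [mul_one] at this
    rw [h1]
    by_cases h0 : (1 : Pt K A).ofConv a = 0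
    · rw [h0, mul_zero]
    · have h2 : IsRegularChr φ l := ⟨((1 : Pt K A).ofConv a)⁻¹ • a, fun t => by
        rw [map_smul, h1, smul_eq_mul]
        field_simp⟩
      have h3 := ht l 0 ⟨l, 0, 0, h2, ⟨1, by simp⟩, by simp, by simp⟩
      rw [h3]
      simp
  have h2 := ht (Pi.single ⟨j, hj⟩ 1) two ⟨0, 0, 1, ⟨1, by simp⟩, ⟨1, by simp⟩, by simp, by simp⟩
  rw [ht1, map_one] at h2
  exact one_ne_zero (two_zpow_injective (K := K) (n := 1) (by rw [zpow_one]; exact h2.symm))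

/-- If the torus has codimension at most one, a closed irreducible set that contains strictly a
translate of the torus is the whole variety. -/
theorem eq_zero_of_vanishing (hφ : IsRegularHom φ) (hinj : Function.Injective φ)
    (hdim : ringKrullDim A = ((r + 1 : ℕ) : WithBot ℕ∞)) (g : (Pt K A)ˣ) {S : Set (Pt K A)}
    (hS : Irr S) (hsub : ∀ t, (φ t * g : Pt K A) ∈ S) {b : A}
    (hb : ∀ t, (φ t * g : Pt K A).ofConv b = 0) {y : Pt K A} (hy : y ∈ S) (hby : y.ofConv b ≠ 0)
    {a : A} (ha : ∀ x ∈ S, x.ofConv a = 0) : a = 0 := by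
  by_contra ha0
  -- `P 0` is the ideal of Tg and `P r` that of the point g, so these primes form a strict chain of
  -- length r. Placing the ideal of `S` and then zero below `P 0` gives length r + 2, which exceeds
  -- the dimension.
  let P : ℕ → PrimeSpectrum A := fun j =>
    ⟨vanishingIdeal ((Set.range fun t => (φ (truncate K r j t) : Pt K A)) * {(g : Pt K A)}),
      ((irr_torus hφ (truncate_isMonomialHom j)).mul (irr_singleton _)).isPrime⟩
  have hP : ∀ j a, a ∈ (P j).asIdeal ↔
      ∀ t, (φ (truncate K r j t) * g : Pt K A).ofConv a = 0 := by
    intro j a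
    change a ∈ vanishingIdeal _ ↔ _
    rw [mem_vanishingIdeal]
    constructor
    · exact fun h t => h _ (Set.mul_mem_mul ⟨t, rfl⟩ rfl)
    · rintro h _ ⟨_, ⟨t, rfl⟩, _, rfl, rfl⟩
      exact h t
  have hlt : ∀ j, j < r → P j < P (j + 1) := by
    intro j hj
    refine lt_of_le_of_ne (fun a ha => ?_) fun h => ?_
    · rw [hP] at ha ⊢
      intro t
      have : truncate K r (j + 1) t = truncate K r j (truncate K r (j + 1) t) := by
        ext i
        by_cases h : (i : ℕ) < j
        · simp [truncate, h]
          omega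
        · simp [truncate, h]
      rw [this]
      exact ha _
    · obtain ⟨a, ha, t, ht⟩ := exists_eval_truncate_ne_zero hφ hinj hj
      have h1 : rtrans ((g⁻¹ : (Pt K A)ˣ) : Pt K A) a ∈ (P (j + 1)).asIdeal := by
        rw [hP]
        intro t
        rw [eval_rtrans, mul_assoc, Units.mul_inv, mul_one, ha]
      rw [← h, hP] at h1
      have := h1 t
      rw [eval_rtrans, mul_assoc, Units.mul_inv, mul_one] at this
      exact ht this
  have hco : ∀ k j, k + j = r → (k : ℕ∞) ≤ Order.coheight (P j) := by
    intro k
    induction k with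
    | zero => intro j _; simp
    | succ k ih =>
      intro j hj
      have h1 := ih (j + 1) (by omega)
      calc ((k + 1 : ℕ) : ℕ∞) = k + 1 := by push_cast; rfl
        _ ≤ Order.coheight (P (j + 1)) + 1 := by gcongr
        _ ≤ Order.coheight (P j) := Order.coheight_add_one_le (hlt j (by omega))
  let Q : PrimeSpectrum A := ⟨vanishingIdeal S, hS.isPrime⟩
  have hQ : Q < P 0 := by
    have ht0 : ∀ t : Fin r → Kˣ, truncate K r 0 t = t := fun t => by ext i; simp [truncate]
    refine lt_of_le_of_ne (fun a ha => ?_) fun h => ?_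
    · rw [hP]
      intro t
      rw [ht0]
      exact mem_vanishingIdeal.1 ha _ (hsub t)
    · have h1 : b ∈ (P 0).asIdeal := by
        rw [hP]
        intro t
        rw [ht0]
        exact hb t
      rw [← h] at h1
      exact hby (mem_vanishingIdeal.1 h1 y hy)
  let Z : PrimeSpectrum A := ⟨⊥, Ideal.isPrime_bot⟩
  have hZ : Z < Q := by
    refine lt_of_le_of_ne (fun a ha => ?_) fun h => ?_
    · have : a = 0 := ha
      rw [this]
      exact zero_mem _
    · have h1 : a ∈ Q.asIdeal := mem_vanishingIdeal.2 ha
      rw [← h] at h1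
      exact ha0 h1
  have h1 : ((r + 2 : ℕ) : ℕ∞) ≤ Order.coheight Z := by
    calc ((r + 2 : ℕ) : ℕ∞) = (r : ℕ∞) + 1 + 1 := by push_cast; ring
      _ ≤ Order.coheight (P 0) + 1 + 1 := by
        gcongr
        exact hco r 0 rfl
      _ ≤ Order.coheight Q + 1 := by
        gcongr
        exact Order.coheight_add_one_le hQ
      _ ≤ Order.coheight Z := Order.coheight_add_one_le hZ
  have h2 : ((r + 2 : ℕ) : WithBot ℕ∞) ≤ ringKrullDim A :=
    (WithBot.coe_le_coe.2 h1).trans (Order.coheight_le_krullDim Z)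
  rw [hdim] at h2
  have h3 : r + 2 ≤ r + 1 := by exact_mod_cast h2
  omega

end Dimension

end AffineMonoid

namespace AffineMonoid

/-! ### Consequences of an off-diagonal weight -/

section ToricCase

open Pointwise

variable {K A : Type*} [Field K] [CommRing A] [Bialgebra K A] {r : ℕ}
  {φ : (Fin r → Kˣ) →* (Pt K A)ˣ}

theorem mul_weight_mul {l m : Fin r → ℤ} {f : A} (hf : f ∈ weightSpace φ l m)
    (t s : Fin r → Kˣ) (x : Pt K A) :
    (φ t * x * φ s).ofConv f = chr l t * chr m s * x.ofConv f := by
  rw [hf.2, hf.1]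
  ring

theorem irr_torus_range [CharZero K] (hφ : IsRegularHom φ) : Irr (Set.range fun t => (φ t : Pt K A)) :=
  irr_torus hφ (ψ := MonoidHom.id _) fun m => ⟨m, fun _ => rfl⟩

theorem prod_zpow_eq_zpow_sum {G ι : Type*} [CommGroup G] (s : Finset ι) (x : G) (v : ι → ℤ) :
    ∏ k ∈ s, x ^ v k = x ^ ∑ k ∈ s, v k := by
  classical
  induction s using Finset.induction_on with
  | empty => simp
  | insert a s ha ih => rw [Finset.prod_insert ha, Finset.sum_insert ha, ih, zpow_add]

variable [IsAlgClosed K] [IsDomain A] [Algebra.FiniteType K A]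

theorem exists_unit_eval_ne_zero₂ {a b : A} (ha : a ≠ 0) (hb : b ≠ 0) :
    ∃ g : (Pt K A)ˣ, (g : Pt K A).ofConv a ≠ 0 ∧ (g : Pt K A).ofConv b ≠ 0 := by
  obtain ⟨g, hg⟩ := exists_unit_eval_ne_zero (K := K) (mul_ne_zero ha hb)
  rw [map_mul] at hg
  exact ⟨g, left_ne_zero_of_mul hg, right_ne_zero_of_mul hg⟩

variable [CharZero K]

/-- If some weight is not diagonal, the weight spaces are at most one-dimensional. -/
theorem weightSpace_mul_eq (hφ : IsRegularHom φ) (hinj : Function.Injective φ)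
    (hdim : ringKrullDim A = ((r + 1 : ℕ) : WithBot ℕ∞)) {l₀ m₀ : Fin r → ℤ} {f₀ : A}
    (hlm : l₀ ≠ m₀) (hf₀ : f₀ ∈ weightSpace φ l₀ m₀) (hf₀0 : f₀ ≠ 0)
    {l m : Fin r → ℤ} {f f' : A} (hf : f ∈ weightSpace φ l m) (hf' : f' ∈ weightSpace φ l m)
    (hf0 : f ≠ 0) : ∃ c : K, f' = c • f := by
  obtain ⟨h₀, hh₀, hh1⟩ := exists_diag_left hφ hf₀ hf₀0
  have hh0 : h₀ ≠ 0 := by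
    rintro rfl
    simp at hh1
  obtain ⟨g, hg, hg'⟩ := exists_unit_eval_ne_zero₂ (K := K) hf0 (mul_ne_zero hf₀0 hh0)
  rw [map_mul] at hg'
  obtain ⟨s, hs⟩ : ∃ s : Fin r → Kˣ, chr l₀ s ≠ chr m₀ s := by
    by_contra! h
    exact hlm (chr_injective h)
  -- f₀ and h₀ share the left weight l₀, so `b` vanishes on Tg; their right weights differ at `s`,
  -- so `b` is nonzero at g φ(s). Hence TgT is dense, while f and f' are proportional on it.
  have key := eq_zero_of_vanishing hφ hinj hdim g
    (S := (Set.range fun t => (φ t : Pt K A)) * {(g : Pt K A)} *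
      (Set.range fun t => (φ t : Pt K A)))
    (((irr_torus_range hφ).mul (irr_singleton _)).mul (irr_torus_range hφ))
    (fun t => ⟨_, Set.mul_mem_mul ⟨t, rfl⟩ rfl, 1, ⟨1, by simp⟩, by simp⟩)
    (b := (g : Pt K A).ofConv h₀ • f₀ - (g : Pt K A).ofConv f₀ • h₀)
    (fun t => by
      simp only [map_sub, map_smul, smul_eq_mul]
      rw [hf₀.1, hh₀.1]
      ring)
    (y := g * φ s) (a := (g : Pt K A).ofConv f • f' - (g : Pt K A).ofConv f' • f)
  have := key (by
      refine ⟨_, ⟨1, ⟨1, by simp⟩, g, rfl, one_mul _⟩, _, ⟨s, rfl⟩, rfl⟩) (by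
      simp only [map_sub, map_smul, smul_eq_mul]
      rw [hf₀.2, hh₀.2]
      have h1 : (chr m₀ s : K) - chr l₀ s ≠ 0 := sub_ne_zero.2 fun h => hs (Units.ext h.symm)
      have h2 := mul_ne_zero h1 hg'
      intro h3
      apply h2
      rw [← h3]
      ring) (by
      rintro _ ⟨_, ⟨_, ⟨t, rfl⟩, _, rfl, rfl⟩, _, ⟨s, rfl⟩, rfl⟩
      simp only [map_sub, map_smul, smul_eq_mul]
      rw [mul_weight_mul hf, mul_weight_mul hf']
      ring)
  refine ⟨((g : Pt K A).ofConv f)⁻¹ * (g : Pt K A).ofConv f', ?_⟩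
  rw [mul_smul, ← sub_eq_zero.1 this, smul_smul, inv_mul_cancel₀ hg, one_smul]

/-- The differences of the left and the right weights are pairwise proportional. -/
theorem weight_sub_mul_eq (hφ : IsRegularHom φ) (hinj : Function.Injective φ)
    (hdim : ringKrullDim A = ((r + 1 : ℕ) : WithBot ℕ∞)) {l₀ m₀ : Fin r → ℤ} {f₀ : A}
    (hf₀ : f₀ ∈ weightSpace φ l₀ m₀) (hf₀0 : f₀ ≠ 0)
    {l m : Fin r → ℤ} {f : A} (hf : f ∈ weightSpace φ l m) (hf0 : f ≠ 0) (i j : Fin r) :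
    (m₀ i - l₀ i) * (m j - l j) = (m₀ j - l₀ j) * (m i - l i) := by
  by_contra hne
  have hlm : l₀ ≠ m₀ := by
    rintro rfl
    simp at hne
  obtain ⟨h₀, hh₀, hh1⟩ := exists_diag_left hφ hf₀ hf₀0
  obtain ⟨h, hh, hh1'⟩ := exists_diag_left hφ hf hf0
  have hh₀0 : h₀ ≠ 0 := by
    rintro rfl
    simp at hh1
  have hh0 : h ≠ 0 := by
    rintro rfl
    simp at hh1'
  obtain ⟨g, hg, hg'⟩ := exists_unit_eval_ne_zero₂ (K := K) (mul_ne_zero hf0 hh0)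
    (mul_ne_zero hf₀0 hh₀0)
  rw [map_mul] at hg hg'
  -- A cocharacter orthogonal to m₀ - l₀ but, by the nonzero minor, not to m - l. The pair f, h
  -- shows that Tg times this one-parameter subgroup is dense, while f₀ and h₀ are proportional on
  -- it; evaluating at 1 gives f₀(g) = 0, a contradiction.
  let v : Fin r → ℤ := Pi.single j (m₀ i - l₀ i) - Pi.single i (m₀ j - l₀ j)
  let ψ : (Fin r → Kˣ) →* (Fin r → Kˣ) :=
    { toFun := fun t k => t i ^ v k
      map_one' := by ext; simp
      map_mul' := fun s t => by ext; simp [mul_zpow] }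
  have hψ : ∀ n t, chr n (ψ t) =
      t i ^ ((m₀ i - l₀ i) * n j - (m₀ j - l₀ j) * n i) := by
    intro n t
    have h1 : chr n (ψ t) = t i ^ ∑ k, v k * n k := by
      rw [chr_apply, ← prod_zpow_eq_zpow_sum]
      exact Finset.prod_congr rfl fun k _ => (zpow_mul _ _ _).symm
    rw [h1]
    congr 1
    simp [v, sub_mul, Finset.sum_sub_distrib, Pi.single_apply]
  have hψm : IsMonomialHom ψ := fun n => ⟨Pi.single i _, fun t => by rw [hψ, chr_single]⟩
  have hs : chr l (ψ fun _ => Units.mk0 (2 : K) two_ne_zero) ≠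
      chr m (ψ fun _ => Units.mk0 (2 : K) two_ne_zero) := by
    rw [hψ, hψ]
    intro h
    rw [← div_eq_one, div_eq_mul_inv, ← zpow_sub] at h
    have := two_zpow_injective h
    apply hne
    linarith
  have key := eq_zero_of_vanishing hφ hinj hdim g
    (S := (Set.range fun t => (φ t : Pt K A)) * {(g : Pt K A)} *
      (Set.range fun t => (φ (ψ t) : Pt K A)))
    (((irr_torus_range hφ).mul (irr_singleton _)).mul (irr_torus hφ hψm))
    (fun t => ⟨_, Set.mul_mem_mul ⟨t, rfl⟩ rfl, 1, ⟨1, by simp⟩, by simp⟩)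
    (b := (g : Pt K A).ofConv h • f - (g : Pt K A).ofConv f • h)
    (fun t => by
      simp only [map_sub, map_smul, smul_eq_mul]
      rw [hf.1, hh.1]
      ring)
    (y := g * φ (ψ fun _ => Units.mk0 (2 : K) two_ne_zero))
    (a := (g : Pt K A).ofConv h₀ • f₀ - (g : Pt K A).ofConv f₀ • h₀)
  have h0 := key (by
      refine ⟨_, ⟨1, ⟨1, by simp⟩, g, rfl, one_mul _⟩, _, ⟨_, rfl⟩, rfl⟩) (by
      simp only [map_sub, map_smul, smul_eq_mul]
      rw [hf.2, hh.2]
      have h1 := sub_ne_zero.2 fun h => hs (Units.ext h.symm)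
      have h2 := mul_ne_zero h1 hg
      intro h3
      apply h2
      rw [← h3]
      ring) (by
      rintro _ ⟨_, ⟨_, ⟨t, rfl⟩, _, rfl, rfl⟩, _, ⟨s, rfl⟩, rfl⟩
      simp only [map_sub, map_smul, smul_eq_mul]
      have h1 : chr m₀ (ψ s) = chr l₀ (ψ s) := by
        rw [hψ, hψ]
        congr 1
        ring
      rw [mul_weight_mul hf₀, mul_weight_mul hh₀, h1]
      ring)
  have h2 := congrArg (1 : Pt K A).ofConv h0
  simp only [map_sub, map_smul, smul_eq_mul, map_zero] at h2
  rw [eval_one_eq_zero hlm hf₀, hh1, mul_zero, zero_sub, mul_one, neg_eq_zero] at h2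
  exact left_ne_zero_of_mul hg' h2

end ToricCase

end AffineMonoid

namespace AffineMonoid

/-! ### Multiplicative diagonal functions and the triangular comultiplication -/

section Toric

variable {K A : Type*} [Field K] [CommRing A] [Bialgebra K A] {r : ℕ}
  {φ : (Fin r → Kˣ) →* (Pt K A)ˣ}

/-- The weight spaces for the left and right translations are at most one-dimensional, and the
differences of right and left weights are positive multiples of one weight. -/
structure IsToric (φ : (Fin r → Kˣ) →* (Pt K A)ˣ) (κ : (Fin r → ℤ) →+ ℤ) : Prop where
  unique : ∀ {l m f f'}, f ∈ weightSpace φ l m → f' ∈ weightSpace φ l m → f ≠ 0 →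
    ∃ c : K, f' = c • f
  lt : ∀ {l m f}, f ∈ weightSpace φ l m → f ≠ 0 → l ≠ m → κ l < κ m
  proportional : ∀ {l m f l' m' f'}, f ∈ weightSpace φ l m → f ≠ 0 → f' ∈ weightSpace φ l' m' →
    f' ≠ 0 → (κ m - κ l) • (m' - l') = (κ m' - κ l') • (m - l)

theorem exists_isToric [CharZero K] [IsAlgClosed K] [IsDomain A] [Algebra.FiniteType K A]
    (hφ : IsRegularHom φ) (hinj : Function.Injective φ)
    (hdim : ringKrullDim A = ((r + 1 : ℕ) : WithBot ℕ∞)) {l₀ m₀ : Fin r → ℤ} {f₀ : A}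
    (hlm : l₀ ≠ m₀) (hf₀ : f₀ ∈ weightSpace φ l₀ m₀) (hf₀0 : f₀ ≠ 0) : ∃ κ, IsToric φ κ := by
  obtain ⟨i, hi⟩ := Function.ne_iff.1 hlm
  -- The sign orients the coordinate `i` so that κ is positive on m₀ - l₀.
  let ε : ℤ := (m₀ i - l₀ i).sign
  let κ : (Fin r → ℤ) →+ ℤ := (AddMonoidHom.mulLeft ε).comp (Pi.evalAddMonoidHom _ i)
  have hκ : ∀ v, κ v = ε * v i := fun v => rfl
  have hκ0 : 0 < κ m₀ - κ l₀ := by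
    rw [hκ, hκ, ← mul_sub, Int.sign_mul_self_eq_abs]
    exact abs_pos.2 (sub_ne_zero.2 (Ne.symm hi))
  have hprop : ∀ {l m f l' m' f'}, f ∈ weightSpace φ l m → f ≠ 0 → f' ∈ weightSpace φ l' m' →
      f' ≠ 0 → (κ m - κ l) • (m' - l') = (κ m' - κ l') • (m - l) := by
    intro l m f l' m' f' hf hf0 hf' hf'0
    funext j
    have := weight_sub_mul_eq hφ hinj hdim hf hf0 hf' hf'0 i j
    simp only [hκ, Pi.smul_apply, Pi.sub_apply, smul_eq_mul]
    linear_combination ε * this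
  have huniq : ∀ {l m f f'}, f ∈ weightSpace φ l m → f' ∈ weightSpace φ l m → f ≠ 0 →
      ∃ c : K, f' = c • f :=
    fun hf hf' h0 => weightSpace_mul_eq hφ hinj hdim hlm hf₀ hf₀0 hf hf' h0
  refine ⟨κ, huniq, fun {l m f} hf hf0 hne => ?_, hprop⟩
  by_contra hle
  have h1 := hprop hf₀ hf₀0 hf hf0
  have h2 : κ m - κ l ≠ 0 := by
    intro h
    rw [h, zero_smul, smul_eq_zero, sub_eq_zero] at h1
    rcases h1 with h1 | h1
    · omega
    · exact hne (sub_eq_zero.1 h1).symm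
  -- If m - l pointed the opposite way, a product of powers of f and f₀ would have diagonal weight.
  -- By uniqueness it would span that weight space, which contains a function equal to 1 at the
  -- unity, although f vanishes there.
  obtain ⟨k₀, hk₀⟩ := Int.eq_ofNat_of_zero_le hκ0.le
  obtain ⟨k, hk⟩ := Int.eq_ofNat_of_zero_le (show 0 ≤ κ l - κ m by omega)
  have h3 := mul_mem_weightSpace (pow_mem_weightSpace hf k₀) (pow_mem_weightSpace hf₀ k)
  have h4 : k₀ • l + k • l₀ = k₀ • m + k • m₀ := by
    rw [hk₀, show κ m - κ l = -(k : ℤ) by omega, neg_smul, natCast_zsmul, natCast_zsmul,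
      smul_sub, smul_sub] at h1
    rw [← sub_eq_zero]
    have h5 := sub_eq_zero.2 h1
    rw [← neg_eq_zero, ← h5]
    abel
  rw [← h4] at h3
  have h5 : f ^ k₀ * f₀ ^ k ≠ 0 := mul_ne_zero (pow_ne_zero _ hf0) (pow_ne_zero _ hf₀0)
  obtain ⟨h, hh, hh1⟩ := exists_diag_left hφ h3 h5
  obtain ⟨c, hc⟩ := huniq h3 hh h5
  rw [hc, map_smul, map_mul, map_pow, eval_one_eq_zero hne hf, zero_pow (by omega), zero_mul,
    smul_zero] at hh1
  exact zero_ne_one hh1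

open Classical in
/-- The function of weight `(l, l)` that takes the value `1` at the unity, if there is one. -/
noncomputable def chi (φ : (Fin r → Kˣ) →* (Pt K A)ˣ) (l : Fin r → ℤ) : A :=
  if h : ∃ f ∈ weightSpace φ l l, (1 : Pt K A).ofConv f = 1 then h.choose else 0

theorem chi_mem (l : Fin r → ℤ) : chi φ l ∈ weightSpace φ l l := by
  unfold chi
  split_ifs with h
  · exact h.choose_spec.1
  · exact zero_mem _

theorem chi_one {l : Fin r → ℤ} (h : ∃ f ∈ weightSpace φ l l, (1 : Pt K A).ofConv f = 1) :
    (1 : Pt K A).ofConv (chi φ l) = 1 := by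
  unfold chi
  rw [dif_pos h]
  exact h.choose_spec.2

variable {κ : (Fin r → ℤ) →+ ℤ}

theorem IsToric.eq_smul_chi (hT : IsToric φ κ) {l : Fin r → ℤ} {f : A}
    (hf : f ∈ weightSpace φ l l) (h1 : (1 : Pt K A).ofConv (chi φ l) = 1) :
    f = (1 : Pt K A).ofConv f • chi φ l := by
  obtain ⟨c, hc⟩ := hT.unique (chi_mem l) hf (by rintro h; simp [h] at h1)
  have : (1 : Pt K A).ofConv f = c := by rw [hc, map_smul, h1, smul_eq_mul, mul_one]
  rw [this, hc]

theorem IsToric.chi_add (hT : IsToric φ κ) {l m : Fin r → ℤ}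
    (hl : (1 : Pt K A).ofConv (chi φ l) = 1) (hm : (1 : Pt K A).ofConv (chi φ m) = 1) :
    chi φ (l + m) = chi φ l * chi φ m ∧ (1 : Pt K A).ofConv (chi φ (l + m)) = 1 := by
  have h1 := mul_mem_weightSpace (chi_mem (φ := φ) l) (chi_mem m)
  have h2 : (1 : Pt K A).ofConv (chi φ l * chi φ m) = 1 := by rw [map_mul, hl, hm, mul_one]
  have h3 : (1 : Pt K A).ofConv (chi φ (l + m)) = 1 := chi_one ⟨_, h1, h2⟩
  have h4 := hT.eq_smul_chi h1 h3
  rw [h2, one_smul] at h4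
  exact ⟨h4.symm, h3⟩

theorem IsToric.chi_nsmul (hT : IsToric φ κ) {l : Fin r → ℤ}
    (hl : (1 : Pt K A).ofConv (chi φ l) = 1) (n : ℕ) :
    chi φ (n • l) = chi φ l ^ n ∧ (1 : Pt K A).ofConv (chi φ (n • l)) = 1 := by
  induction n with
  | zero =>
    have h3 : (1 : Pt K A).ofConv (chi φ 0) = 1 := chi_one ⟨1, one_mem_weightSpace, by simp⟩
    have h4 := hT.eq_smul_chi one_mem_weightSpace h3
    rw [map_one, one_smul] at h4
    rw [zero_smul, pow_zero]
    exact ⟨h4.symm, h3⟩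
  | succ n ih =>
    rw [succ_nsmul, pow_succ, ← ih.1]
    exact hT.chi_add ih.2 hl

variable [CharZero K] [IsAlgClosed K] [IsDomain A] [Algebra.FiniteType K A]

/-- An intermediate weight n ≠ l would need nonzero vectors of weights (l, n) and (n, l), hence κ l
< κ n < κ l. Only the term n = l survives, and one-dimensionality makes it a product. -/
theorem IsToric.chi_mul (hT : IsToric φ κ) (hφ : IsRegularHom φ) (l : Fin r → ℤ) (x y : Pt K A) :
    (x * y).ofConv (chi φ l) = x.ofConv (chi φ l) * y.ofConv (chi φ l) := by
  by_cases h0 : chi φ l = 0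
  · simp [h0]
  have h1 : (1 : Pt K A).ofConv (chi φ l) = 1 := chi_one (exists_diag_left hφ (chi_mem l) h0)
  obtain ⟨s, F, hF0, hF, hl, hr⟩ := exists_weight_expansion hφ (chi_mem (φ := φ) l)
  have h2 : ∀ n, n ≠ l → ∀ x y, F n x y = 0 := by
    intro n hn x y
    obtain ⟨a, ha, hax⟩ := hl n y
    obtain ⟨b, hb, hby⟩ := hr n x
    by_contra h
    have ha0 : a ≠ 0 := by rintro rfl; exact h (by rw [← hax, map_zero])
    have hb0 : b ≠ 0 := by rintro rfl; exact h (by rw [← hby, map_zero])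
    have := hT.lt ha ha0 (Ne.symm hn)
    have := hT.lt hb hb0 hn
    omega
  have h3 : ∀ x y : Pt K A, (x * y).ofConv (chi φ l) = F l x y := by
    intro x y
    rw [hF, Finset.sum_eq_single l (fun n _ hn => h2 n hn x y) (fun h => hF0 l h x y)]
  obtain ⟨a, ha, hax⟩ := hl l y
  have h4 := hT.eq_smul_chi ha h1
  rw [h3, ← hax, h4, map_smul, smul_eq_mul, hax, ← h3, one_mul, mul_comm]

/-- The comultiplication of a function of non-diagonal weight is triangular. -/
theorem IsToric.exists_expansion (hT : IsToric φ κ) (hφ : IsRegularHom φ) {l m : Fin r → ℤ} {f : A}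
    (hf : f ∈ weightSpace φ l m) (hf0 : f ≠ 0) (hlm : l ≠ m) :
    ∃ (s : Finset (Fin r → ℤ)) (F : (Fin r → ℤ) → Pt K A → Pt K A → K),
      (∀ x y : Pt K A, (x * y).ofConv f = x.ofConv (chi φ l) * y.ofConv f +
        x.ofConv f * y.ofConv (chi φ m) + ∑ n ∈ s, F n x y) ∧
      (∀ n ∈ s, κ l < κ n ∧ κ n < κ m) ∧
      (∀ n y, ∃ a ∈ weightSpace φ l n, ∀ x : Pt K A, x.ofConv a = F n x y) ∧
      ∀ n x, ∃ a ∈ weightSpace φ n m, ∀ y : Pt K A, y.ofConv a = F n x y := by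
  classical
  obtain ⟨s, F, hF0, hF, hl, hr⟩ := exists_weight_expansion hφ hf
  have hl1 : (1 : Pt K A).ofConv (chi φ l) = 1 := chi_one (exists_diag_left hφ hf hf0)
  have hm1 : (1 : Pt K A).ofConv (chi φ m) = 1 := chi_one (exists_diag_right hφ hf hf0)
  -- As a function of x this term lies on the line of χ_l; the factor is found at x = 1, where every
  -- other term vanishes.
  have hFl : ∀ x y, F l x y = x.ofConv (chi φ l) * y.ofConv f := by
    intro x y
    have h1 : y.ofConv f = F l 1 y := by
      rw [← one_mul y, hF, one_mul]
      refine Finset.sum_eq_single l (fun n _ hn => ?_) (fun h => hF0 l h _ _)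
      obtain ⟨a, ha, hax⟩ := hl n y
      rw [← hax, eval_one_eq_zero (Ne.symm hn) ha]
    obtain ⟨a, ha, hax⟩ := hl l y
    have h4 := hT.eq_smul_chi ha hl1
    rw [h1, ← hax, ← hax, h4, map_smul, map_smul, smul_eq_mul, smul_eq_mul, hl1]
    ring
  have hFm : ∀ x y, F m x y = x.ofConv f * y.ofConv (chi φ m) := by
    intro x y
    have h1 : x.ofConv f = F m x 1 := by
      rw [← mul_one x, hF, mul_one]
      refine Finset.sum_eq_single m (fun n _ hn => ?_) (fun h => hF0 m h _ _)
      obtain ⟨a, ha, hax⟩ := hr n x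
      rw [← hax, eval_one_eq_zero hn ha]
    obtain ⟨a, ha, hax⟩ := hr m x
    have h4 := hT.eq_smul_chi ha hm1
    rw [h1, ← hax, ← hax, h4, map_smul, map_smul, smul_eq_mul, smul_eq_mul, hm1]
    ring
  refine ⟨s.filter fun n => κ l < κ n ∧ κ n < κ m, F, fun x y => ?_,
    fun n hn => (Finset.mem_filter.1 hn).2, hl, hr⟩
  set t := s.filter fun n => κ l < κ n ∧ κ n < κ m with ht
  have hlm' : κ l < κ m := hT.lt hf hf0 hlm
  have h0 : ∀ n, n ∉ insert l (insert m t) → F n x y = 0 := by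
    intro n hn
    simp only [Finset.mem_insert, not_or] at hn
    by_contra h
    obtain ⟨a, ha, hax⟩ := hl n y
    obtain ⟨b, hb, hby⟩ := hr n x
    have ha0 : a ≠ 0 := by rintro rfl; exact h (by rw [← hax, map_zero])
    have hb0 : b ≠ 0 := by rintro rfl; exact h (by rw [← hby, map_zero])
    have hns : n ∈ s := by
      by_contra hns
      exact h (hF0 n hns x y)
    exact hn.2.2 (Finset.mem_filter.2 ⟨hns, hT.lt ha ha0 (Ne.symm hn.1), hT.lt hb hb0 hn.2.1⟩)
  have h1 : ∑ n ∈ s, F n x y = ∑ n ∈ insert l (insert m t), F n x y := by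
    rw [Finset.sum_subset (Finset.subset_union_left (s₂ := insert l (insert m t)))
      (fun n _ hn => hF0 n hn x y), ← Finset.sum_subset Finset.subset_union_right
      (fun n _ hn => h0 n hn)]
  rw [hF, h1, Finset.sum_insert, Finset.sum_insert, hFl, hFm, add_assoc]
  · simp [ht]
  · simp [ht, hlm]

end Toric

end AffineMonoid

namespace AffineMonoid

/-! ### Conjugacy of idempotents in the toric case -/

section ToricIdempotents

variable {K A : Type*} [Field K] [CommRing A] [Bialgebra K A] {r : ℕ}
  {φ : (Fin r → Kˣ) →* (Pt K A)ˣ} {κ : (Fin r → ℤ) →+ ℤ}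

theorem exists_torus_point_of_submonoid [IsAlgClosed K]
    (S : AddSubmonoid ((Fin r → ℤ) × Additive Kˣ))
    (hS : ∀ m u u', (m, u) ∈ S → (m, u') ∈ S → u = u') :
    ∃ t : Fin r → Kˣ, ∀ m u, (m, u) ∈ S → chr m t = u.toMul := by
  let G : AddSubgroup ((Fin r → ℤ) × Additive Kˣ) :=
    { carrier := {p | ∃ x ∈ S, ∃ y ∈ S, p = x - y}
      zero_mem' := ⟨0, S.zero_mem, 0, S.zero_mem, by simp⟩
      add_mem' := by
        rintro _ _ ⟨x, hx, y, hy, rfl⟩ ⟨x', hx', y', hy', rfl⟩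
        exact ⟨x + x', S.add_mem hx hx', y + y', S.add_mem hy hy', by abel⟩
      neg_mem' := by
        rintro _ ⟨x, hx, y, hy, rfl⟩
        exact ⟨y, hy, x, hx, by abel⟩ }
  obtain ⟨t, ht⟩ := exists_torus_point G (by
    rintro u ⟨⟨m, v⟩, hx, ⟨m', v'⟩, hy, h⟩
    simp only [Prod.mk_sub_mk, Prod.mk.injEq] at h
    obtain ⟨h1, rfl⟩ := h
    rw [sub_eq_zero.1 h1.symm] at hx
    rw [hS _ _ _ hx hy, sub_self])
  exact ⟨t, fun m u hmu => ht m u ⟨(m, u), hmu, 0, S.zero_mem, by simp⟩⟩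

theorem IsToric.exists_smul_eq (hT : IsToric φ κ) {l m l' m' : Fin r → ℤ} {p q : A}
    (hp : p ∈ weightSpace φ l m) (hq : q ∈ weightSpace φ l' m') (hl : l = l') (hm : m = m')
    (hp0 : p ≠ 0) (hq0 : q ≠ 0) : ∃ c : K, c ≠ 0 ∧ p = c • q := by
  subst hl hm
  obtain ⟨c, hc⟩ := hT.unique hq hp hq0
  refine ⟨c, ?_, hc⟩
  rintro rfl
  exact hp0 (by rw [hc, zero_smul])

theorem chi_ne_zero {l : Fin r → ℤ} (h : (1 : Pt K A).ofConv (chi φ l) = 1) : chi φ l ≠ 0 := by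
  intro h0
  simp [h0] at h

theorem mem_conjClass_symm {x y : Pt K A} (h : y ∈ conjClass x) : x ∈ conjClass y := by
  obtain ⟨g, rfl⟩ := h
  exact ⟨g⁻¹, by simp [mul_assoc]⟩

theorem mem_conjClass_trans {x y z : Pt K A} (h : y ∈ conjClass x) (h' : z ∈ conjClass y) :
    z ∈ conjClass x := by
  obtain ⟨g, rfl⟩ := h
  obtain ⟨k, rfl⟩ := h'
  exact ⟨k * g, by simp [mul_assoc]⟩

theorem idempotent_of_mem_conjClass {e x : Pt K A} (he : e * e = e) (hx : x ∈ conjClass e) :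
    x * x = x := by
  obtain ⟨g, rfl⟩ := hx
  calc _ = (g : Pt K A) * (e * ((g⁻¹ * g : (Pt K A)ˣ) : Pt K A) * e) * (g⁻¹ : (Pt K A)ˣ) := by
        simp only [Units.val_mul, mul_assoc]
    _ = _ := by rw [inv_mul_cancel, Units.val_one, mul_one, he]

variable [CharZero K] [IsAlgClosed K] [IsDomain A] [Algebra.FiniteType K A]

theorem chi_one_left (hφ : IsRegularHom φ) {l m : Fin r → ℤ} {f : A}
    (hf : f ∈ weightSpace φ l m) (hf0 : f ≠ 0) : (1 : Pt K A).ofConv (chi φ l) = 1 :=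
  chi_one (exists_diag_left hφ hf hf0)

theorem chi_one_right (hφ : IsRegularHom φ) {l m : Fin r → ℤ} {f : A}
    (hf : f ∈ weightSpace φ l m) (hf0 : f ≠ 0) : (1 : Pt K A).ofConv (chi φ m) = 1 :=
  chi_one (exists_diag_right hφ hf hf0)

theorem IsToric.chi_eq_zero_or_one (hT : IsToric φ κ) (hφ : IsRegularHom φ) (l : Fin r → ℤ)
    {e : Pt K A} (he : e * e = e) : e.ofConv (chi φ l) = 0 ∨ e.ofConv (chi φ l) = 1 := by
  have h := hT.chi_mul hφ l e e
  rw [he] at h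
  by_cases h0 : e.ofConv (chi φ l) = 0
  · exact Or.inl h0
  · exact Or.inr (mul_left_cancel₀ h0 (by rw [← h, mul_one]))

/-- The weights of two functions of non-diagonal weight are related. -/
theorem IsToric.exists_relation (hT : IsToric φ κ) (hφ : IsRegularHom φ)
    {l m l' m' : Fin r → ℤ} {f f' : A} (hf : f ∈ weightSpace φ l m) (hf0 : f ≠ 0) (hlm : l ≠ m)
    (hf' : f' ∈ weightSpace φ l' m') (hf'0 : f' ≠ 0) (hlm' : l' ≠ m') :
    ∃ k k' : ℕ, k ≠ 0 ∧ k' ≠ 0 ∧ k • m' + k' • l = k • l' + k' • m ∧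
      (chi φ m' : A) ^ k * chi φ l ^ k' = chi φ l' ^ k * chi φ m ^ k' := by
  have h1 := hT.lt hf hf0 hlm
  have h2 := hT.lt hf' hf'0 hlm'
  have h3 := hT.proportional hf hf0 hf' hf'0
  -- The exponents are the κ-lengths of the two differences, crossed as in the proportionality
  -- relation.
  obtain ⟨k, hk⟩ := Int.eq_ofNat_of_zero_le (show 0 ≤ κ m - κ l by omega)
  obtain ⟨k', hk'⟩ := Int.eq_ofNat_of_zero_le (show 0 ≤ κ m' - κ l' by omega)
  have h4 : k • m' + k' • l = k • l' + k' • m := by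
    rw [hk, hk', natCast_zsmul, natCast_zsmul, smul_sub, smul_sub] at h3
    rw [← sub_eq_zero] at h3 ⊢
    rw [← h3]
    abel
  refine ⟨k, k', by omega, by omega, h4, ?_⟩
  have hl := hT.chi_nsmul (chi_one_left hφ hf hf0) k'
  have hm := hT.chi_nsmul (chi_one_right hφ hf hf0) k'
  have hl' := hT.chi_nsmul (chi_one_left hφ hf' hf'0) k
  have hm' := hT.chi_nsmul (chi_one_right hφ hf' hf'0) k
  rw [← hl.1, ← hm.1, ← hl'.1, ← hm'.1, ← (hT.chi_add hm'.2 hl.2).1, h4,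
    (hT.chi_add hl'.2 hm.2).1]

/-- A function of non-diagonal weight that does not vanish at an idempotent has exactly one of its
two weights in the face of the idempotent. -/
theorem IsToric.chi_alternative (hT : IsToric φ κ) (hφ : IsRegularHom φ) {e : Pt K A}
    (he : e * e = e) {l m : Fin r → ℤ} {f : A} (hf : f ∈ weightSpace φ l m) (hlm : l ≠ m)
    (hfe : e.ofConv f ≠ 0) :
    (e.ofConv (chi φ l) = 1 ∧ e.ofConv (chi φ m) = 0) ∨
      (e.ofConv (chi φ l) = 0 ∧ e.ofConv (chi φ m) = 1) := by
  obtain ⟨d, hd⟩ : ∃ d : ℕ, (κ m - κ l).toNat = d := ⟨_, rfl⟩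
  induction d using Nat.strong_induction_on generalizing l m f with
  | _ d ih =>
  have hf0 : f ≠ 0 := by rintro rfl; exact hfe (map_zero _)
  obtain ⟨s, F, hF, hs, hl, hr⟩ := hT.exists_expansion hφ hf hf0 hlm
  have h1 := hF e e
  rw [he] at h1
  -- A nonzero middle term gives vectors of weights (l, n) and (n, m) alive at e. By induction χ_l
  -- and χ_n differ at e, but if χ_l and χ_m agree there, the relation equates powers of χ_l(e) and
  -- χ_n(e).
  have key : ∑ n ∈ s, F n e e ≠ 0 → e.ofConv (chi φ l) = e.ofConv (chi φ m) → False := by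
    intro hsum heq
    obtain ⟨n, hn, hne⟩ := Finset.exists_ne_zero_of_sum_ne_zero hsum
    obtain ⟨hn1, hn2⟩ := hs n hn
    obtain ⟨a, ha, hax⟩ := hl n e
    obtain ⟨b, hb, hby⟩ := hr n e
    have hae : e.ofConv a ≠ 0 := by rwa [hax]
    have hbe : e.ofConv b ≠ 0 := by rwa [hby]
    have hln : l ≠ n := by rintro rfl; exact lt_irrefl _ hn1
    have hnm : n ≠ m := by rintro rfl; exact lt_irrefl _ hn2
    have h2 := ih _ (by omega) ha hln hae rfl
    have ha0 : a ≠ 0 := by rintro rfl; exact hae (map_zero _)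
    have hb0 : b ≠ 0 := by rintro rfl; exact hbe (map_zero _)
    obtain ⟨k, k', hk, hk', -, h3⟩ := hT.exists_relation hφ ha ha0 hln hb hb0 hnm
    have h4 := congrArg e.ofConv h3
    simp only [map_mul, map_pow] at h4
    rw [← heq] at h4
    rcases h2 with ⟨h5, h6⟩ | ⟨h5, h6⟩ <;> simp [h5, h6, hk, hk'] at h4
  rcases hT.chi_eq_zero_or_one hφ l he with h2 | h2 <;>
    rcases hT.chi_eq_zero_or_one hφ m he with h3 | h3
  · refine (key ?_ (by rw [h2, h3])).elim
    rw [h2, h3, zero_mul, mul_zero, zero_add, zero_add] at h1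
    rwa [← h1]
  · exact Or.inr ⟨h2, h3⟩
  · exact Or.inl ⟨h2, h3⟩
  · refine (key ?_ (by rw [h2, h3])).elim
    rw [h2, h3] at h1
    intro h4
    rw [h4] at h1
    apply hfe
    linear_combination -h1

/-- The relation between the χ's would read 1 = 0 at e. Thus either the left weights of all
off-diagonal vectors alive at an idempotent are in its face, or the right weights are. -/
theorem IsToric.not_opposite (hT : IsToric φ κ) (hφ : IsRegularHom φ) {e : Pt K A}
    {l m l' m' : Fin r → ℤ} {f f' : A} (hf : f ∈ weightSpace φ l m) (hf0 : f ≠ 0) (hlm : l ≠ m)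
    (hf' : f' ∈ weightSpace φ l' m') (hf'0 : f' ≠ 0) (hlm' : l' ≠ m')
    (hl : e.ofConv (chi φ l) = 1) (hm : e.ofConv (chi φ m) = 0)
    (hl' : e.ofConv (chi φ l') = 0) (hm' : e.ofConv (chi φ m') = 1) : False := by
  obtain ⟨k, k', hk, hk', -, h3⟩ := hT.exists_relation hφ hf hf0 hlm hf' hf'0 hlm'
  have h4 := congrArg e.ofConv h3
  simp [hl, hm, hl', hm', hk, hk'] at h4

/-- Two idempotents in the same face and not in the closure of the torus lie in the zero loci of
the same weight vectors. -/
theorem IsToric.support_subset (hT : IsToric φ κ) (hφ : IsRegularHom φ) {e e' : Pt K A}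
    (he : e * e = e) (he' : e' * e' = e')
    (hchi : ∀ l, e.ofConv (chi φ l) = e'.ofConv (chi φ l))
    {l₀ m₀ : Fin r → ℤ} {f₀ : A} (hf₀ : f₀ ∈ weightSpace φ l₀ m₀) (hlm₀ : l₀ ≠ m₀)
    (hfe₀ : e'.ofConv f₀ ≠ 0) {l m : Fin r → ℤ} {f : A} (hf : f ∈ weightSpace φ l m) (hlm : l ≠ m)
    (hfe : e.ofConv f ≠ 0) : e'.ofConv f ≠ 0 := by
  have hf0 : f ≠ 0 := by rintro rfl; exact hfe (map_zero _)
  have hf₀0 : f₀ ≠ 0 := by rintro rfl; exact hfe₀ (map_zero _)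
  have h1 := hT.chi_alternative hφ he hf hlm hfe
  have h2 := hT.chi_alternative hφ he' hf₀ hlm₀ hfe₀
  simp only [hchi] at h1
  obtain ⟨k, k', hk, hk', h3, -⟩ := hT.exists_relation hφ hf hf0 hlm hf₀ hf₀0 hlm₀
  have hcl := chi_ne_zero (chi_one_left hφ hf hf0)
  have hcm := chi_ne_zero (chi_one_right hφ hf hf0)
  have hcl₀ := chi_ne_zero (chi_one_left hφ hf₀ hf₀0)
  have hcm₀ := chi_ne_zero (chi_one_right hφ hf₀ hf₀0)
  have hp := pow_mem_weightSpace hf k'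
  have hq := pow_mem_weightSpace hf₀ k
  rcases h1 with ⟨h1l, h1m⟩ | ⟨h1l, h1m⟩ <;> rcases h2 with ⟨h2l, h2m⟩ | ⟨h2l, h2m⟩
  -- Multiplying powers of f and f₀ by χ's that equal 1 at e' brings both to the same weight, so
  -- they are proportional and their nonvanishing at e' is equivalent.
  · obtain ⟨c, hc, hcc⟩ := hT.exists_smul_eq
      (mul_mem_weightSpace hp (pow_mem_weightSpace (chi_mem l₀) k))
      (mul_mem_weightSpace hq (pow_mem_weightSpace (chi_mem l) k')) (add_comm _ _)
      (by rw [h3, add_comm]) (mul_ne_zero (pow_ne_zero _ hf0) (pow_ne_zero _ hcl₀))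
      (mul_ne_zero (pow_ne_zero _ hf₀0) (pow_ne_zero _ hcl))
    have h4 := congrArg e'.ofConv hcc
    simp only [map_mul, map_pow, map_smul, h1l, h2l, one_pow, mul_one, smul_eq_mul] at h4
    intro h5
    rw [h5, zero_pow hk'] at h4
    exact mul_ne_zero hc (pow_ne_zero k hfe₀) h4.symm
  · exact (hT.not_opposite hφ hf hf0 hlm hf₀ hf₀0 hlm₀ h1l h1m h2l h2m).elim
  · exact (hT.not_opposite hφ hf₀ hf₀0 hlm₀ hf hf0 hlm h2l h2m h1l h1m).elim
  · obtain ⟨c, hc, hcc⟩ := hT.exists_smul_eq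
      (mul_mem_weightSpace hp (pow_mem_weightSpace (chi_mem m₀) k))
      (mul_mem_weightSpace hq (pow_mem_weightSpace (chi_mem m) k'))
      (by rw [← h3, add_comm]) (add_comm _ _) (mul_ne_zero (pow_ne_zero _ hf0)
      (pow_ne_zero _ hcm₀)) (mul_ne_zero (pow_ne_zero _ hf₀0) (pow_ne_zero _ hcm))
    have h4 := congrArg e'.ofConv hcc
    simp only [map_mul, map_pow, map_smul, h1m, h2m, one_pow, mul_one, smul_eq_mul] at h4
    intro h5
    rw [h5, zero_pow hk'] at h4
    exact mul_ne_zero hc (pow_ne_zero k hfe₀) h4.symm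

theorem IsToric.eval_diag_eq (hT : IsToric φ κ) (hφ : IsRegularHom φ) {e e' : Pt K A}
    (hchi : ∀ l, e.ofConv (chi φ l) = e'.ofConv (chi φ l)) {l : Fin r → ℤ} {f : A}
    (hf : f ∈ weightSpace φ l l) : e.ofConv f = e'.ofConv f := by
  by_cases hf0 : f = 0
  · simp [hf0]
  · rw [hT.eq_smul_chi hf (chi_one_left hφ hf hf0), map_smul, map_smul, hchi]

/-- Two idempotents in the same face and not in the closure of the torus are conjugate under the
torus. -/
theorem IsToric.mem_conjClass_of_ne_zero (hT : IsToric φ κ) (hφ : IsRegularHom φ) {e e' : Pt K A}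
    (he : e * e = e) (he' : e' * e' = e')
    (hchi : ∀ l, e.ofConv (chi φ l) = e'.ofConv (chi φ l))
    {l₀ m₀ : Fin r → ℤ} {f₀ : A} (hf₀ : f₀ ∈ weightSpace φ l₀ m₀) (hlm₀ : l₀ ≠ m₀)
    (hfe₀ : e.ofConv f₀ ≠ 0)
    {l₁ m₁ : Fin r → ℤ} {f₁ : A} (hf₁ : f₁ ∈ weightSpace φ l₁ m₁) (hlm₁ : l₁ ≠ m₁)
    (hfe₁ : e'.ofConv f₁ ≠ 0) : e' ∈ conjClass e := by
  -- Conjugation by φ(t) scales a value on weight (l, m) by the character l - m, so `t` must send l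
  -- - m to e'(f)/e(f) wherever both values are nonzero.
  let S : AddSubmonoid ((Fin r → ℤ) × Additive Kˣ) :=
    { carrier := {p | ∃ l m, ∃ f ∈ weightSpace φ l m, e.ofConv f ≠ 0 ∧ e'.ofConv f ≠ 0 ∧
        p.1 = l - m ∧ (p.2.toMul : K) * e.ofConv f = e'.ofConv f}
      zero_mem' := ⟨0, 0, 1, one_mem_weightSpace, by simp⟩
      add_mem' := by
        rintro p q ⟨l, m, f, hf, h1, h2, h3, h4⟩ ⟨l', m', f', hf', h1', h2', h3', h4'⟩
        refine ⟨l + l', m + m', f * f', mul_mem_weightSpace hf hf', ?_, ?_, ?_, ?_⟩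
        · rw [map_mul]; exact mul_ne_zero h1 h1'
        · rw [map_mul]; exact mul_ne_zero h2 h2'
        · rw [Prod.fst_add, h3, h3']; abel
        · rw [map_mul, map_mul, ← h4, ← h4', Prod.snd_add, toMul_add, Units.val_mul]; ring }
  obtain ⟨t, ht⟩ := exists_torus_point_of_submonoid S (by
    rintro n u u' ⟨l, m, f, hf, h1, h2, h3, h4⟩ ⟨l', m', f', hf', h1', h2', h3', h4'⟩
    simp only at h3 h4 h3' h4'
    rw [h3] at h3'
    have hf0 : f ≠ 0 := by rintro rfl; exact h1 (map_zero _)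
    have hf'0 : f' ≠ 0 := by rintro rfl; exact h1' (map_zero _)
    -- The ratio depends only on l - m: multiplying each function by the χ of the other's surviving
    -- weight gives proportional functions with the same values at e and e'.
    have hratio : e'.ofConv f * e.ofConv f' = e.ofConv f * e'.ofConv f' := by
      by_cases hlm : l = m
      · subst hlm
        rw [sub_self, eq_comm, sub_eq_zero] at h3'
        subst h3'
        rw [hT.eval_diag_eq hφ hchi hf, hT.eval_diag_eq hφ hchi hf']
      · have hlm' : l' ≠ m' := by
          rintro rfl
          rw [sub_self, sub_eq_zero] at h3'
          exact hlm h3'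
        have hcl := chi_ne_zero (chi_one_left hφ hf hf0)
        have hcm := chi_ne_zero (chi_one_right hφ hf hf0)
        have hcl' := chi_ne_zero (chi_one_left hφ hf' hf'0)
        have hcm' := chi_ne_zero (chi_one_right hφ hf' hf'0)
        have ha := hT.chi_alternative hφ he hf hlm h1
        have hb := hT.chi_alternative hφ he hf' hlm' h1'
        have h5 : m + l' = m' + l := by
          rw [sub_eq_sub_iff_add_eq_add] at h3'
          rw [add_comm m, ← h3', add_comm]
        rcases ha with ⟨hal, ham⟩ | ⟨hal, ham⟩ <;> rcases hb with ⟨hbl, hbm⟩ | ⟨hbl, hbm⟩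
        · obtain ⟨c, hc, hcc⟩ := hT.exists_smul_eq (mul_mem_weightSpace hf (chi_mem l'))
            (mul_mem_weightSpace hf' (chi_mem l)) (add_comm _ _) h5
            (mul_ne_zero hf0 hcl') (mul_ne_zero hf'0 hcl)
          have h6 := congrArg e.ofConv hcc
          have h7 := congrArg e'.ofConv hcc
          simp only [map_mul, map_smul, ← hchi, hal, hbl, mul_one, smul_eq_mul] at h6 h7
          rw [h6, h7]
          ring
        · exact (hT.not_opposite hφ hf hf0 hlm hf' hf'0 hlm' hal ham hbl hbm).elim
        · exact (hT.not_opposite hφ hf' hf'0 hlm' hf hf0 hlm hbl hbm hal ham).elim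
        · obtain ⟨c, hc, hcc⟩ := hT.exists_smul_eq (mul_mem_weightSpace hf (chi_mem m'))
            (mul_mem_weightSpace hf' (chi_mem m)) (by
              rw [sub_eq_sub_iff_add_eq_add] at h3'
              exact h3') (add_comm _ _)
            (mul_ne_zero hf0 hcm') (mul_ne_zero hf'0 hcm)
          have h6 := congrArg e.ofConv hcc
          have h7 := congrArg e'.ofConv hcc
          simp only [map_mul, map_smul, ← hchi, ham, hbm, mul_one, smul_eq_mul] at h6 h7
          rw [h6, h7]
          ring
    apply Additive.toMul.injective
    apply Units.ext
    refine mul_right_cancel₀ (mul_ne_zero h1 h1') ?_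
    linear_combination e.ofConv f' * h4 - e.ofConv f * h4' + hratio)
  refine ⟨φ t, Pt.ext_of_span (span_weightSpace hφ) ?_⟩
  rintro f ⟨l, m, hf⟩
  have h1 : (φ t * e * ((φ t)⁻¹ : (Pt K A)ˣ) : Pt K A).ofConv f = chr (l - m) t * e.ofConv f := by
    rw [← map_inv, mul_weight_mul hf, chr_sub, map_inv, Units.val_div_eq_div_val,
      Units.val_inv_eq_inv_val, div_eq_mul_inv]
  rw [h1]
  by_cases hlm : l = m
  · subst hlm
    rw [sub_self, chr_zero, Units.val_one, one_mul, hT.eval_diag_eq hφ hchi hf]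
  · by_cases hfe : e.ofConv f = 0
    · rw [hfe, mul_zero]
      by_contra hfe'
      exact hT.support_subset hφ he' he (fun l => (hchi l).symm) hf₀ hlm₀ hfe₀ hf hlm hfe' hfe
    · have hfe' := hT.support_subset hφ he he' hchi hf₁ hlm₁ hfe₁ hf hlm hfe
      have h2 := ht (l - m) (Additive.ofMul (Units.mk0 _ hfe' / Units.mk0 _ hfe))
        ⟨l, m, f, hf, hfe, hfe', rfl, by simp [hfe]⟩
      rw [h2]
      simp [hfe]

/-- Idempotents in the same face are conjugate. -/
theorem IsToric.mem_conjClass (hT : IsToric φ κ) (hφ : IsRegularHom φ) {e e' : Pt K A}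
    (he : e * e = e) (he' : e' * e' = e')
    (hchi : ∀ l, e.ofConv (chi φ l) = e'.ofConv (chi φ l)) : e' ∈ conjClass e := by
  have hconj : ∀ (g : (Pt K A)ˣ) (e : Pt K A) l,
      (g * e * ((g⁻¹ : (Pt K A)ˣ) : Pt K A)).ofConv (chi φ l) = e.ofConv (chi φ l) := by
    intro g e l
    by_cases h0 : chi φ l = 0
    · simp [h0]
    · have h1 := hT.chi_mul hφ l (g : Pt K A) ((g⁻¹ : (Pt K A)ˣ) : Pt K A)
      rw [Units.mul_inv, chi_one_left hφ (chi_mem l) h0] at h1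
      rw [hT.chi_mul hφ, hT.chi_mul hφ]
      linear_combination -(e.ofConv (chi φ l)) * h1
  -- The mixed case, where e kills all off-diagonal vectors and e' does not: e is replaced by a
  -- conjugate that does not kill all of them.
  have key : ∀ {e e' : Pt K A}, e * e = e → e' * e' = e' →
      (∀ l, e.ofConv (chi φ l) = e'.ofConv (chi φ l)) →
      (∀ l m, l ≠ m → ∀ f ∈ weightSpace φ l m, e.ofConv f = 0) →
      (¬ ∀ l m, l ≠ m → ∀ f ∈ weightSpace φ l m, e'.ofConv f = 0) → e' ∈ conjClass e := by
    intro e e' he he' hchi h1 h2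
    push Not at h2
    obtain ⟨l, m, hlm, f, hf, hfe⟩ := h2
    have hf0 : f ≠ 0 := by rintro rfl; exact hfe (map_zero _)
    by_cases h3 : ∀ g : (Pt K A)ˣ, ∀ l m, l ≠ m → ∀ f ∈ weightSpace φ l m,
        (g * e * ((g⁻¹ : (Pt K A)ˣ) : Pt K A)).ofConv f = 0
    · exfalso
      have hcen : ∀ g : (Pt K A)ˣ, g * e = e * g := by
        intro g
        -- If every conjugate of e killed the off-diagonal vectors, e would commute with all units.
        -- Comparing f(xe) with f(ex) then gives χ_l(e) = χ_m(e), against the alternative at e'.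
        have h4 : g * e * ((g⁻¹ : (Pt K A)ˣ) : Pt K A) = e := by
          refine Pt.ext_of_span (span_weightSpace hφ) ?_
          rintro f ⟨l, m, hf⟩
          by_cases hlm : l = m
          · subst hlm
            exact hT.eval_diag_eq hφ (hconj g e) hf
          · rw [h1 l m hlm f hf, h3 g l m hlm f hf]
        calc g * e = g * e * ((g⁻¹ : (Pt K A)ˣ) : Pt K A) * g := by
              rw [mul_assoc _ _ (g : Pt K A), Units.inv_mul, mul_one]
          _ = _ := by rw [h4]
      obtain ⟨s, F, hF, hs, hl, hr⟩ := hT.exists_expansion hφ hf hf0 hlm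
      have h5 : ∀ x, (x * e).ofConv f = x.ofConv f * e.ofConv (chi φ m) := by
        intro x
        rw [hF, h1 l m hlm f hf, mul_zero, zero_add, Finset.sum_eq_zero, add_zero]
        intro n hn
        obtain ⟨a, ha, hax⟩ := hr n x
        rw [← hax]
        exact h1 n m (by rintro rfl; exact lt_irrefl _ (hs _ hn).2) a ha
      have h6 : ∀ x, (e * x).ofConv f = e.ofConv (chi φ l) * x.ofConv f := by
        intro x
        rw [hF, h1 l m hlm f hf, zero_mul, add_zero, Finset.sum_eq_zero, add_zero]
        intro n hn
        obtain ⟨a, ha, hax⟩ := hl n x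
        rw [← hax]
        exact h1 l n (by rintro rfl; exact lt_irrefl _ (hs _ hn).1) a ha
      obtain ⟨g, hg⟩ := exists_unit_eval_ne_zero (K := K) hf0
      have h7 := h5 g
      rw [hcen, h6, mul_comm] at h7
      have h8 := mul_left_cancel₀ hg h7
      have h9 := hT.chi_alternative hφ he' hf hlm hfe
      rw [← hchi, ← hchi, h8] at h9
      rcases h9 with ⟨h9, h10⟩ | ⟨h9, h10⟩ <;> simp [h10] at h9
    · push Not at h3
      obtain ⟨g, l₀, m₀, hlm₀, f₀, hf₀, hfe₀⟩ := h3
      have hg : g * e * ((g⁻¹ : (Pt K A)ˣ) : Pt K A) ∈ conjClass e := ⟨g, rfl⟩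
      refine mem_conjClass_trans hg ?_
      exact hT.mem_conjClass_of_ne_zero hφ (idempotent_of_mem_conjClass he hg) he'
        (fun l => by rw [hconj, hchi]) hf₀ hlm₀ hfe₀ hf hlm hfe
  by_cases h1 : ∀ l m, l ≠ m → ∀ f ∈ weightSpace φ l m, e.ofConv f = 0 <;>
    by_cases h2 : ∀ l m, l ≠ m → ∀ f ∈ weightSpace φ l m, e'.ofConv f = 0
  · have : e' = e := by
      refine Pt.ext_of_span (span_weightSpace hφ) ?_
      rintro f ⟨l, m, hf⟩
      by_cases hlm : l = m
      · subst hlm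
        exact (hT.eval_diag_eq hφ hchi hf).symm
      · rw [h1 l m hlm f hf, h2 l m hlm f hf]
    exact ⟨1, by simp [this]⟩
  · exact key he he' hchi h1 h2
  · exact mem_conjClass_symm (key he' he (fun l => (hchi l).symm) h2 h1)
  · push Not at h1 h2
    obtain ⟨l₀, m₀, hlm₀, f₀, hf₀, hfe₀⟩ := h1
    obtain ⟨l₁, m₁, hlm₁, f₁, hf₁, hfe₁⟩ := h2
    exact hT.mem_conjClass_of_ne_zero hφ he he' hchi hf₀ hlm₀ hfe₀ hf₁ hlm₁ hfe₁

end ToricIdempotents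

end AffineMonoid

namespace AffineMonoid

/-! ### Trace arguments in finite-dimensional algebras -/

section Algebras

variable {K V : Type*} [Field K] [AddCommGroup V] [Module K V] [Module.Finite K V]

/-- An operator all of whose powers have trace zero is nilpotent. -/
theorem isNilpotent_of_trace_pow_eq_zero [CharZero K] {a : Module.End K V}
    (h : ∀ k : ℕ, k ≠ 0 → LinearMap.trace K V (a ^ k) = 0) : IsNilpotent a := by
  have hp0 : minpoly K a ≠ 0 := minpoly.ne_zero (Algebra.IsIntegral.isIntegral a)
  obtain ⟨q, hq, hXq⟩ := Polynomial.exists_eq_pow_rootMultiplicity_mul_and_not_dvd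
    (minpoly K a) hp0 0
  rw [map_zero, sub_zero] at hq hXq
  set m := Polynomial.rootMultiplicity 0 (minpoly K a)
  have hco : IsCoprime (Polynomial.X ^ (m + 1)) q :=
    IsCoprime.pow_left ((Polynomial.irreducible_X.coprime_iff_not_dvd).2 hXq)
  obtain ⟨u, v, huv⟩ := hco
  have hmin : Polynomial.aeval a (Polynomial.X ^ m * q) = 0 := by rw [← hq, minpoly.aeval]
  -- The Bézout projection onto the part where `a` is invertible. The exponent m + 1 removes the
  -- constant term even when m = 0, so the trace is zero and, in characteristic zero, so is the
  -- projection.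
  set e := Polynomial.aeval a (u * Polynomial.X ^ (m + 1)) with he
  have he1 : e + Polynomial.aeval a (v * q) = 1 := by
    rw [he, ← map_add, huv, map_one]
  have he2 : e * Polynomial.aeval a (v * q) = 0 := by
    rw [he, ← map_mul, show u * Polynomial.X ^ (m + 1) * (v * q) =
      (u * v * Polynomial.X) * (Polynomial.X ^ m * q) by ring, map_mul, hmin, mul_zero]
  have hid : IsIdempotentElem e := by
    have h1 : e * (e + Polynomial.aeval a (v * q)) = e := by rw [he1, mul_one]
    rwa [mul_add, he2, add_zero] at h1
  have htr : LinearMap.trace K V e = 0 := by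
    rw [he, Polynomial.aeval_eq_sum_range, map_sum]
    refine Finset.sum_eq_zero fun i _ => ?_
    rw [map_smul]
    rcases Nat.eq_zero_or_pos i with rfl | hi
    · rw [pow_succ, ← mul_assoc, Polynomial.mul_coeff_zero, Polynomial.coeff_X_zero, mul_zero,
        zero_smul]
    · rw [h i hi.ne', smul_zero]
  have he0 : e = 0 := (LinearMap.IsIdempotentElem.trace_eq_zero_iff hid).1 htr
  rw [he0, zero_add] at he1
  refine ⟨m, ?_⟩
  calc a ^ m = a ^ m * Polynomial.aeval a (v * q) := by rw [he1, mul_one]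
    _ = Polynomial.aeval a (v * (Polynomial.X ^ m * q)) := by
      rw [show v * (Polynomial.X ^ m * q) = Polynomial.X ^ m * (v * q) by ring,
        map_mul (Polynomial.aeval a) (Polynomial.X ^ m), map_pow, Polynomial.aeval_X]
    _ = 0 := by rw [map_mul, hmin, mul_zero]

/-- An idempotent nil ideal of codimension one in a finite-dimensional algebra is zero. -/
theorem eq_zero_of_nil_of_idempotent (R : Subalgebra K (Module.End K V))
    (τ : Module.End K V →ₗ[K] K) (hτ : ∀ a ∈ R, ∀ b ∈ R, τ (a * b) = τ a * τ b)
    (hnil : ∀ a ∈ R, τ a = 0 → IsNilpotent a)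
    (hN : ∀ a ∈ R, τ a = 0 →
      a ∈ Submodule.span K {x | ∃ b ∈ R, ∃ c ∈ R, τ b = 0 ∧ τ c = 0 ∧ x = b * c})
    {a : Module.End K V} (ha : a ∈ R) (ha0 : τ a = 0) : a = 0 := by
  have hfin : Module.Finite K R := inferInstanceAs (Module.Finite K R.toSubmodule)
  have hart : IsArtinianRing R := IsArtinianRing.of_finite K R
  let J : Ideal R := Ideal.jacobson ⊥
  have hJ : ∀ b : R, τ (b : Module.End K V) = 0 → b ∈ J := by
    intro b hb
    rw [Ideal.mem_jacobson_iff]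
    intro y
    have h1 : τ ((y * b : R) : Module.End K V) = 0 := by
      rw [Subalgebra.coe_mul, hτ _ y.2 _ b.2, hb, mul_zero]
    obtain ⟨n, hn⟩ := hnil _ (y * b).2 h1
    have h2 : IsNilpotent (y * b) := ⟨n, Subtype.ext ((SubmonoidClass.coe_pow _ n).trans hn)⟩
    obtain ⟨z, hz⟩ := h2.isUnit_add_one
    refine ⟨((z⁻¹ : Rˣ) : R), ?_⟩
    have h3 : ((z⁻¹ : Rˣ) : R) * (y * b + 1) = 1 := by rw [← hz, Units.inv_mul]
    rw [Ideal.mem_bot, mul_assoc, ← h3, mul_add, mul_one, sub_self]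
  -- The kernel of τ lies in the Jacobson radical and is spanned by its own products, so it lies in
  -- every power of that nilpotent ideal.
  have hpow : ∀ i : ℕ, ∀ b : R, τ (b : Module.End K V) = 0 → b ∈ J ^ i := by
    intro i
    induction i with
    | zero =>
      intro b _
      rw [Submodule.pow_zero, Ideal.one_eq_top]
      exact Submodule.mem_top
    | succ i ih =>
      intro b hb
      have h1 : ∀ x ∈ Submodule.span K
          {x | ∃ b ∈ R, ∃ c ∈ R, τ b = 0 ∧ τ c = 0 ∧ x = b * c}, ∀ hx : x ∈ R,
          (⟨x, hx⟩ : R) ∈ J ^ (i + 1) := by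
        have h2 : Submodule.span K {x | ∃ b ∈ R, ∃ c ∈ R, τ b = 0 ∧ τ c = 0 ∧ x = b * c} ≤
            ((J ^ (i + 1)).restrictScalars K).map R.val.toLinearMap := by
          rw [Submodule.span_le]
          rintro _ ⟨b, hb, c, hc, hb0, hc0, rfl⟩
          refine ⟨⟨b, hb⟩ * ⟨c, hc⟩, ?_, rfl⟩
          change _ ∈ J ^ (i + 1)
          rw [Submodule.pow_succ]
          exact Ideal.mul_mem_mul (ih ⟨b, hb⟩ hb0) (hJ ⟨c, hc⟩ hc0)
        intro x hx hxR
        obtain ⟨y, hy, rfl⟩ := h2 hx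
        exact hy
      exact h1 b (hN b b.2 hb) b.2
  obtain ⟨n, hn⟩ := IsArtinianRing.isNilpotent_jacobson_bot (R := R)
  have h1 := hpow n ⟨a, ha⟩ ha0
  change _ ∈ (Ideal.jacobson ⊥ : Ideal R) ^ n at h1
  rw [hn] at h1
  exact congrArg Subtype.val ((Submodule.mem_bot R).1 h1)

/-- A representation on which the normalized trace is multiplicative, and on which every class
function is a multiple of the trace, is scalar. -/
theorem scalar_of_trace_mul [CharZero K] {M : Type*} [Monoid M] (ρ : M →* Module.End K V)
    (hn : Module.finrank K V ≠ 0)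
    (hmul : ∀ x y, (Module.finrank K V : K)⁻¹ * LinearMap.trace K V (ρ (x * y)) =
      ((Module.finrank K V : K)⁻¹ * LinearMap.trace K V (ρ x)) *
        ((Module.finrank K V : K)⁻¹ * LinearMap.trace K V (ρ y)))
    (huniq : ∀ ℓ : Module.End K V →ₗ[K] K, (∀ x y, ℓ (ρ x * ρ y) = ℓ (ρ y * ρ x)) →
      ∃ c : K, ∀ x, ℓ (ρ x) = c * ((Module.finrank K V : K)⁻¹ * LinearMap.trace K V (ρ x)))
    (x : M) : ρ x = ((Module.finrank K V : K)⁻¹ * LinearMap.trace K V (ρ x)) • 1 := by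
  set n := Module.finrank K V with hndef
  have hn0' : (n : K) ≠ 0 := Nat.cast_ne_zero.2 hn
  let τ : Module.End K V →ₗ[K] K := (n : K)⁻¹ • LinearMap.trace K V
  have hτρ : ∀ a, (n : K)⁻¹ * LinearMap.trace K V a = τ a := fun a => rfl
  simp only [hτρ] at hmul huniq ⊢
  have hτ1 : τ 1 = 1 := by
    rw [← hτρ, LinearMap.trace_one, inv_mul_cancel₀ hn0']
  let R : Subalgebra K (Module.End K V) := Algebra.adjoin K (Set.range ρ)
  have hRspan : Subalgebra.toSubmodule R = Submodule.span K (Set.range ρ) := by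
    have : (Submonoid.closure (Set.range ρ) : Set (Module.End K V)) =
        Set.range ρ := by
      rw [← MonoidHom.coe_mrange, Submonoid.closure_eq]
    rw [Algebra.adjoin_eq_span, this]
  have hspan : ∀ a ∈ R, a ∈ Submodule.span K (Set.range ρ) := fun a ha => by
    rw [← hRspan]; exact ha
  have hρR : ∀ x, ρ x ∈ R := fun x => Algebra.subset_adjoin ⟨x, rfl⟩
  have hτmul : ∀ a ∈ R, ∀ b ∈ R, τ (a * b) = τ a * τ b := by
    intro a ha b hb
    replace ha := hspan a ha
    replace hb := hspan b hb
    induction ha using Submodule.span_induction with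
    | zero => simp
    | add a a' _ _ h1 h2 => rw [add_mul, map_add, map_add, h1, h2, add_mul]
    | smul c a _ h1 => rw [smul_mul_assoc, map_smul, map_smul, h1, smul_eq_mul, smul_eq_mul,
        mul_assoc]
    | mem a ha =>
      obtain ⟨x, rfl⟩ := ha
      induction hb using Submodule.span_induction with
      | zero => simp
      | add a a' _ _ h1 h2 => rw [mul_add, map_add, map_add, h1, h2, mul_add]
      | smul c a _ h1 => rw [mul_smul_comm, map_smul, map_smul, h1, smul_eq_mul, smul_eq_mul,
          mul_left_comm]
      | mem b hb =>
        obtain ⟨y, rfl⟩ := hb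
        rw [← map_mul, hmul]
  have hnil : ∀ a ∈ R, τ a = 0 → IsNilpotent a := by
    intro a ha ha0
    refine isNilpotent_of_trace_pow_eq_zero fun k hk => ?_
    obtain ⟨k, rfl⟩ := Nat.exists_eq_succ_of_ne_zero hk
    have h1 : τ (a ^ (k + 1)) = 0 := by
      rw [pow_succ, hτmul _ (pow_mem ha k) _ ha, ha0, mul_zero]
    rw [← hτρ] at h1
    exact (mul_eq_zero.1 h1).resolve_left (inv_ne_zero hn0')
  have hN : ∀ a ∈ R, τ a = 0 →
      a ∈ Submodule.span K {x | ∃ b ∈ R, ∃ c ∈ R, τ b = 0 ∧ τ c = 0 ∧ x = b * c} := by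
    intro a ha ha0
    by_contra hnot
    -- Write N for the kernel of τ on `R`. A functional killing N² is a class function, since each
    -- ρ(x) is a scalar plus an element of N. It is then a multiple of τ and kills N, against the
    -- choice of ℓ.
    obtain ⟨ℓ, hℓa, hℓ⟩ := Submodule.exists_le_ker_of_notMem (K := K)
      (V := Module.End K V) hnot
    have hℓ0 : ∀ b ∈ R, ∀ c ∈ R, τ b = 0 → τ c = 0 → ℓ (b * c) = 0 := fun b hb c hc h1 h2 =>
      hℓ (Submodule.subset_span ⟨b, hb, c, hc, h1, h2, rfl⟩)
    have hν : ∀ x, ρ x - τ (ρ x) • 1 ∈ R ∧ τ (ρ x - τ (ρ x) • 1) = 0 := fun x =>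
      ⟨R.sub_mem (hρR x) (R.smul_mem (one_mem R) _), by
        rw [map_sub, map_smul, hτ1, smul_eq_mul, mul_one, sub_self]⟩
    obtain ⟨c, hc⟩ := huniq ℓ (fun x y => by
      have h1 := hℓ0 _ (hν x).1 _ (hν y).1 (hν x).2 (hν y).2
      have h2 := hℓ0 _ (hν y).1 _ (hν x).1 (hν y).2 (hν x).2
      simp only [sub_mul, mul_sub, smul_mul_assoc, mul_smul_comm, one_mul, mul_one, map_sub,
        map_smul, smul_eq_mul] at h1 h2
      linear_combination h1 - h2)
    have h3 : ∀ b ∈ Submodule.span K (Set.range ρ), ℓ b = c * τ b := by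
      intro b hb
      induction hb using Submodule.span_induction with
      | zero => simp
      | add a a' _ _ h1 h2 => rw [map_add, map_add, h1, h2, mul_add]
      | smul k a _ h1 => rw [map_smul, map_smul, h1, smul_eq_mul, smul_eq_mul, mul_left_comm]
      | mem b hb =>
        obtain ⟨x, rfl⟩ := hb
        exact hc x
    exact hℓa (by rw [h3 a (hspan a ha), ha0, mul_zero])
  rw [← sub_eq_zero]
  refine eq_zero_of_nil_of_idempotent R τ hτmul hnil hN
    (R.sub_mem (hρR x) (R.smul_mem (one_mem R) _)) ?_
  rw [map_sub, map_smul, hτ1, smul_eq_mul, mul_one, sub_self]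

end Algebras

/-! ### Commutativity when the torus is central -/

section CentralTorus

open Pointwise

variable {K A : Type*} [Field K] [CommRing A] [Bialgebra K A] {r : ℕ}
  {φ : (Fin r → Kˣ) →* (Pt K A)ˣ}

/-- A function invariant under conjugation. -/
def IsClassFunction (K : Type*) {A : Type*} [Field K] [CommRing A] [Bialgebra K A] (a : A) :
    Prop :=
  ∀ x y : Pt K A, (x * y).ofConv a = (y * x).ofConv a

/-- The torus acts on the left and on the right with the same weights. -/
def IsDiagonal (φ : (Fin r → Kˣ) →* (Pt K A)ˣ) : Prop :=
  ∀ l m, ∀ f ∈ weightSpace φ l m, f ≠ 0 → l = m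

variable [IsAlgClosed K] [IsDomain A] [Algebra.FiniteType K A]

/-- With a central torus all translates of f keep the right weight l, so φ(t) acts on their span by
a scalar. -/
theorem rrep_torus_mul {l : Fin r → ℤ} {f : A} (hf : f ∈ rightWeight φ l) (t : Fin r → Kˣ)
    (hc : ∀ t (x : Pt K A), (φ t : Pt K A) * x = x * φ t)
    (x : Pt K A) : rrep {f} ((φ t : Pt K A) * x) = (chr l t : K) • rrep {f} x := by
  have hle : rspan K {f} ≤ rightWeight φ l := by
    refine Submodule.span_le.2 ?_
    rintro _ ⟨_, rfl, x, rfl⟩ t y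
    rw [eval_rtrans, eval_rtrans, mul_assoc, hc, ← mul_assoc, hf]
  ext v
  refine eq_of_eval_eq (K := K) fun y => ?_
  have hv : rtrans x (v : A) ∈ rightWeight φ l := hle (rtrans_mem_rspan x v.2)
  simp only [LinearMap.smul_apply, Submodule.coe_smul, coe_rrep, map_smul, smul_eq_mul]
  rw [rtrans_mul, eval_rtrans, hv]

variable [CharZero K]

theorem IsDiagonal.commute (hd : IsDiagonal φ) (hφ : IsRegularHom φ) (t : Fin r → Kˣ)
    (x : Pt K A) : (φ t : Pt K A) * x = x * φ t := by
  refine Pt.ext_of_span (span_weightSpace hφ) ?_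
  rintro f ⟨l, m, hf⟩
  by_cases hf0 : f = 0
  · simp [hf0]
  · have := hd l m f hf hf0
    subst this
    rw [hf.1, hf.2]

theorem IsDiagonal.mem_weightSpace (hd : IsDiagonal φ) (hφ : IsRegularHom φ) {l : Fin r → ℤ}
    {f : A} (hf : ∀ t (x : Pt K A), (φ t * x).ofConv f = chr l t * x.ofConv f) :
    f ∈ weightSpace φ l l :=
  ⟨hf, fun t x => by rw [← hd.commute hφ, hf]⟩

/-- The trace of the right translations on the span of the translates of `f`. -/
theorem IsDiagonal.exists_trace (hd : IsDiagonal φ) (hφ : IsRegularHom φ) {l : Fin r → ℤ}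
    {f : A} (hf : f ∈ weightSpace φ l l) (hf0 : f ≠ 0) :
    ∃ θ ∈ weightSpace φ l l, IsClassFunction K θ ∧ (1 : Pt K A).ofConv θ = 1 ∧
      ∀ x : Pt K A, x.ofConv θ = (Module.finrank K (rspan K {f}) : K)⁻¹ *
        LinearMap.trace K _ (rrep {f} x) := by
  have := finite_rspan (K := K) (Set.finite_singleton f)
  obtain ⟨θ, hθ⟩ := exists_matrix_coeff {f}
    ((Module.finrank K (rspan K {f}) : K)⁻¹ • LinearMap.trace K (rspan K {f}))
  have hn : (Module.finrank K (rspan K {f}) : K) ≠ 0 := by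
    have : Nontrivial (rspan K {f}) :=
      ⟨⟨⟨f, subset_rspan _ rfl⟩, 0, fun h => hf0 (congrArg Subtype.val h)⟩⟩
    exact Nat.cast_ne_zero.2 Module.finrank_pos.ne'
  simp only [LinearMap.smul_apply, smul_eq_mul] at hθ
  refine ⟨θ, hd.mem_weightSpace hφ fun t x => ?_, fun x y => ?_, ?_, hθ⟩
  · rw [hθ, hθ, rrep_torus_mul hf.2 t (hd.commute hφ), map_smul, smul_eq_mul]
    ring
  · rw [hθ, hθ, map_mul (rrep {f}), map_mul (rrep {f}), LinearMap.trace_mul_comm]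
  · rw [hθ, map_one, LinearMap.trace_one, inv_mul_cancel₀ hn]

theorem IsDiagonal.mul_comm_of_eval (hφ : IsRegularHom φ) (hd : IsDiagonal φ)
    (h : ∀ l, ∀ f ∈ weightSpace φ l l, f ≠ 0 → IsClassFunction K f) (x y : Pt K A) :
    x * y = y * x := by
  refine Pt.ext_of_span (span_weightSpace hφ) ?_
  rintro f ⟨l, m, hf⟩
  by_cases hf0 : f = 0
  · simp [hf0]
  · have := hd l m f hf hf0
    subst this
    exact h l f hf hf0 x y

/-- If there are two independent class functions of the same weight, conjugacy classes have
codimension greater than that of the torus. -/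
theorem IsDiagonal.mul_comm_of_classFunction (hφ : IsRegularHom φ) (hinj : Function.Injective φ)
    (hdim : ringKrullDim A = ((r + 1 : ℕ) : WithBot ℕ∞)) (hd : IsDiagonal φ) {l₀ : Fin r → ℤ}
    {θ θ' : A} (hθ : θ ∈ weightSpace φ l₀ l₀) (hθc : IsClassFunction K θ) (hθ0 : θ ≠ 0)
    (hθ' : θ' ∈ weightSpace φ l₀ l₀) (hθc' : IsClassFunction K θ') (hne : ∀ c : K, θ' ≠ c • θ)
    (x y : Pt K A) : x * y = y * x := by
  refine hd.mul_comm_of_eval hφ (fun l f hf hf0 => ?_) x y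
  obtain ⟨η, hη, hηc, hη1, -⟩ := hd.exists_trace hφ hf hf0
  have hη0 : η ≠ 0 := by
    rintro rfl
    simp at hη1
  have hconj : ∀ {a : A}, IsClassFunction K a → ∀ (x g : (Pt K A)ˣ),
      (x * g * ((x⁻¹ : (Pt K A)ˣ) : Pt K A)).ofConv a = (g : Pt K A).ofConv a := by
    intro a ha x g
    rw [ha, ← mul_assoc, Units.inv_mul, one_mul]
  have h1 : ∀ g : (Pt K A)ˣ, (g : Pt K A).ofConv θ ≠ 0 → (g : Pt K A).ofConv η ≠ 0 →
      ∀ x : (Pt K A)ˣ, (x * g * ((x⁻¹ : (Pt K A)ˣ) : Pt K A)).ofConv f =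
        (g : Pt K A).ofConv f := by
    intro g hg hg' x
    by_contra hne'
    -- If f were not constant on the class of g, T times this class would be dense; but the
    -- independent class functions θ and θ' are proportional there.
    have h2 := eq_zero_of_vanishing hφ hinj hdim g
      (S := (Set.range fun t => (φ t : Pt K A)) * conjClass (g : Pt K A))
      ((irr_torus_range hφ).mul (irr_conjClass _))
      (fun t => ⟨_, ⟨t, rfl⟩, g, ⟨1, by simp⟩, rfl⟩)
      (b := (g : Pt K A).ofConv η • f - (g : Pt K A).ofConv f • η)
      (fun t => by
        simp only [map_sub, map_smul, smul_eq_mul]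
        rw [hf.1, hη.1]
        ring)
      (y := x * g * ((x⁻¹ : (Pt K A)ˣ) : Pt K A))
      ⟨1, ⟨1, by simp⟩, _, ⟨x, rfl⟩, one_mul _⟩
      (by
        simp only [map_sub, map_smul, smul_eq_mul]
        rw [hconj hηc]
        intro h
        apply hne'
        refine mul_left_cancel₀ hg' ?_
        linear_combination h)
      (a := (g : Pt K A).ofConv θ • θ' - (g : Pt K A).ofConv θ' • θ)
      (by
        rintro _ ⟨_, ⟨t, rfl⟩, _, ⟨z, rfl⟩, rfl⟩
        simp only [map_sub, map_smul, smul_eq_mul]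
        rw [hθ.1, hθ'.1, hconj hθc, hconj hθc']
        ring)
    refine hne (((g : Pt K A).ofConv θ)⁻¹ * (g : Pt K A).ofConv θ') ?_
    rw [mul_smul, ← sub_eq_zero.1 h2, smul_smul, inv_mul_cancel₀ hg, one_smul]
  have h2 : ∀ (x : (Pt K A)ˣ), ltrans (x : Pt K A) (rtrans ((x⁻¹ : (Pt K A)ˣ) : Pt K A) f) = f := by
    intro x
    rw [← sub_eq_zero]
    -- The factor θη absorbs the units where `h1` does not apply; it cancels because `A` is a
    -- domain.
    have h3 : (ltrans (x : Pt K A) (rtrans ((x⁻¹ : (Pt K A)ˣ) : Pt K A) f) - f) * (θ * η) = 0 := by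
      refine eq_of_unit_eval_eq (K := K) fun g => ?_
      rw [map_zero, map_mul, map_mul]
      by_cases hg : (g : Pt K A).ofConv θ = 0
      · rw [hg, zero_mul, mul_zero]
      by_cases hg' : (g : Pt K A).ofConv η = 0
      · rw [hg', mul_zero, mul_zero]
      rw [map_sub, eval_ltrans, eval_rtrans, h1 g hg hg', sub_self, zero_mul]
    exact (mul_eq_zero.1 h3).resolve_right (mul_ne_zero hθ0 hη0)
  intro x y
  have h3 : ltrans y f = rtrans y f := by
    refine eq_of_unit_eval_eq (K := K) fun z => ?_
    rw [eval_ltrans, eval_rtrans]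
    have h4 := congrArg (y * (z : Pt K A)).ofConv (h2 z)
    rw [eval_ltrans, eval_rtrans, mul_assoc, mul_assoc, Units.mul_inv, mul_one] at h4
    exact h4.symm
  have h4 := congrArg x.ofConv h3
  rw [eval_ltrans, eval_rtrans] at h4
  exact h4.symm

/-- If class functions are determined by their weights, the monoid is commutative. -/
theorem IsDiagonal.mul_comm_of_unique_classFunction (hφ : IsRegularHom φ) (hd : IsDiagonal φ)
    (huniq : ∀ l, ∀ θ ∈ weightSpace φ l l, IsClassFunction K θ → θ ≠ 0 →
      ∀ θ' ∈ weightSpace φ l l, IsClassFunction K θ' → ∃ c : K, θ' = c • θ) (x y : Pt K A) :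
    x * y = y * x := by
  refine hd.mul_comm_of_eval hφ (fun l f hf hf0 => ?_) x y
  have := finite_rspan (K := K) (Set.finite_singleton f)
  obtain ⟨θ, hθ, hθc, hθ1, hθtr⟩ := hd.exists_trace hφ hf hf0
  set n := Module.finrank K (rspan K {f}) with hn
  set ρ := rrep (K := K) {f} with hρ
  have hn0 : n ≠ 0 := by
    have : Nontrivial (rspan K {f}) :=
      ⟨⟨⟨f, subset_rspan _ rfl⟩, 0, fun h => hf0 (congrArg Subtype.val h)⟩⟩
    exact Module.finrank_pos.ne'
  have hn0' : (n : K) ≠ 0 := Nat.cast_ne_zero.2 hn0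
  have hθ0 : θ ≠ 0 := by
    rintro rfl
    simp at hθ1
  obtain ⟨d, hdet⟩ := exists_det_coeff (K := K) {f}
  have hchr : ∀ t : Fin r → Kˣ, (chr (n • l) t : K) = (chr l t : K) ^ n := by
    intro t
    have : ∀ k : ℕ, chr (k • l) t = chr l t ^ k := by
      intro k
      induction k with
      | zero => simp
      | succ k ih => rw [succ_nsmul, chr_add, ih, pow_succ]
    rw [this, Units.val_pow_eq_pow_val]
  have hdw : d ∈ weightSpace φ (n • l) (n • l) := hd.mem_weightSpace hφ fun t x => by
    rw [hdet, hdet, rrep_torus_mul hf.2 t (hd.commute hφ), LinearMap.det_smul, hchr]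
  -- The determinant and θⁿ are class functions of the same weight with value 1 at the unity, so
  -- they coincide, and θⁿ is multiplicative.
  obtain ⟨c, hc⟩ := huniq (n • l) (θ ^ n) (pow_mem_weightSpace hθ n)
    (fun x y => by rw [map_pow, map_pow, hθc]) (pow_ne_zero _ hθ0) d hdw
    (fun x y => by rw [hdet, hdet, map_mul, map_mul, map_mul, map_mul, mul_comm])
  have hc1 : c = 1 := by
    have := congrArg (1 : Pt K A).ofConv hc
    rw [hdet, map_smul, map_pow, hθ1, map_one, map_one, one_pow, smul_eq_mul, mul_one] at this
    exact this.symm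
  rw [hc1, one_smul] at hc
  have hpow : ∀ x y : Pt K A, (x * y).ofConv θ ^ n = (x.ofConv θ * y.ofConv θ) ^ n := by
    intro x y
    rw [mul_pow, ← map_pow, ← map_pow, ← map_pow, ← hc, hdet, hdet, hdet, map_mul, map_mul]
  have hmul : ∀ x y : Pt K A, (x * y).ofConv θ = x.ofConv θ * y.ofConv θ := by
    intro x y
    by_cases hy : y.ofConv θ = 0
    · have := hpow x y
      rw [hy, mul_zero, zero_pow hn0] at this
      rw [hy, mul_zero]
      exact eq_zero_of_pow_eq_zero this
    -- Two functions with equal n-th powers: the cofactor of their difference takes the value n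
    -- θ(y)ⁿ⁻¹ ≠ 0 at the unity, so no root of unity intervenes.
    · have h1 : (∑ i ∈ Finset.range n, rtrans y θ ^ i * (y.ofConv θ • θ) ^ (n - 1 - i)) *
          (rtrans y θ - y.ofConv θ • θ) = 0 := by
        rw [(Commute.all _ _).geom_sum₂_mul, sub_eq_zero]
        refine eq_of_eval_eq (K := K) fun z => ?_
        rw [map_pow, map_pow, eval_rtrans, hpow, map_smul, smul_eq_mul, mul_comm]
      have h2 : (∑ i ∈ Finset.range n, rtrans y θ ^ i * (y.ofConv θ • θ) ^ (n - 1 - i)) ≠ 0 := by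
        intro h
        have h3 := congrArg (1 : Pt K A).ofConv h
        simp only [map_sum, map_mul, map_pow, eval_rtrans, one_mul, map_smul, smul_eq_mul, hθ1,
          mul_one, map_zero] at h3
        rw [Finset.sum_congr rfl (g := fun _ => y.ofConv θ ^ (n - 1)) (fun i hi => by
          rw [← pow_add]
          congr 1
          have := Finset.mem_range.1 hi
          omega)] at h3
        rw [Finset.sum_const, Finset.card_range, nsmul_eq_mul] at h3
        exact mul_ne_zero hn0' (pow_ne_zero _ hy) h3
      have h3 := (mul_eq_zero.1 h1).resolve_left h2
      have h4 := congrArg x.ofConv (sub_eq_zero.1 h3)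
      rw [eval_rtrans, map_smul, smul_eq_mul] at h4
      rw [h4, mul_comm]
  have hscal : ∀ x, ρ x = x.ofConv θ • 1 := by
    intro x
    rw [hθtr]
    refine scalar_of_trace_mul ρ hn0 (fun x y => ?_) (fun ℓ hℓ => ?_) x
    · rw [← hθtr, ← hθtr, ← hθtr, hmul]
    · obtain ⟨g, hg⟩ := exists_matrix_coeff {f} ℓ
      have hgw : g ∈ weightSpace φ l l := hd.mem_weightSpace hφ fun t x => by
        rw [hg, hg, rrep_torus_mul hf.2 t (hd.commute hφ), map_smul, smul_eq_mul]
      obtain ⟨c, hc⟩ := huniq l θ hθ hθc hθ0 g hgw (fun x y => by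
        rw [hg, hg, map_mul (rrep {f}), map_mul (rrep {f})]
        exact hℓ x y)
      exact ⟨c, fun x => by rw [← hθtr, ← hg, hc, map_smul, smul_eq_mul]⟩
  have hfx : ∀ x y : Pt K A, (y * x).ofConv f = x.ofConv θ * y.ofConv f := by
    intro x y
    have h1 : rtrans x f = x.ofConv θ • f := by
      have := congrArg Subtype.val (LinearMap.congr_fun (hscal x) ⟨f, subset_rspan _ rfl⟩)
      exact this
    rw [← eval_rtrans, h1, map_smul, smul_eq_mul]
  intro x y
  have h1 := hfx x 1
  have h2 := hfx y 1
  rw [one_mul] at h1 h2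
  rw [hfx, hfx, h1, h2]
  ring

/-- If the torus is central and of codimension one, the monoid is commutative. -/
theorem IsDiagonal.mul_comm (hφ : IsRegularHom φ) (hinj : Function.Injective φ)
    (hdim : ringKrullDim A = ((r + 1 : ℕ) : WithBot ℕ∞)) (hd : IsDiagonal φ) (x y : Pt K A) :
    x * y = y * x := by
  by_cases h : ∀ l, ∀ θ ∈ weightSpace φ l l, IsClassFunction K θ → θ ≠ 0 →
      ∀ θ' ∈ weightSpace φ l l, IsClassFunction K θ' → ∃ c : K, θ' = c • θ
  · exact hd.mul_comm_of_unique_classFunction hφ h x y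
  · push Not at h
    obtain ⟨l, θ, hθ, hθc, hθ0, θ', hθ', hθc', hne⟩ := h
    exact hd.mul_comm_of_classFunction hφ hinj hdim hθ hθc hθ0 hθ' hθc' hne x y

end CentralTorus

end AffineMonoid

namespace AffineMonoid

/-! ### Irreducible components of the set of idempotents -/

section Components

variable {K A : Type*} [Field K] [CommRing A] [Bialgebra K A]

theorem Irr.isIrreducible_preimage {S : Set (Pt K A)} (h : Irr S) (hS : S ⊆ idempotents K A) :
    IsIrreducible (Subtype.val ⁻¹' S : Set (idempotents K A)) := by
  obtain ⟨x₀, hx₀⟩ := h.1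
  refine ⟨⟨⟨x₀, hS hx₀⟩, hx₀⟩, ?_⟩
  rw [isPreirreducible_iff_isClosed_union_isClosed]
  intro z₁ z₂ h₁ h₂ hz
  obtain ⟨t₁, ht₁, rfl⟩ := isClosed_induced_iff.1 h₁
  obtain ⟨t₂, ht₂, rfl⟩ := isClosed_induced_iff.1 h₂
  obtain ⟨S₁, rfl⟩ := (isClosed_iff_zeroLocus t₁).1 ht₁
  obtain ⟨S₂, rfl⟩ := (isClosed_iff_zeroLocus t₂).1 ht₂
  by_contra! hne
  obtain ⟨⟨x, hx, hxz⟩, ⟨y, hy, hyz⟩⟩ :=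
    And.intro (Set.not_subset.1 hne.1) (Set.not_subset.1 hne.2)
  simp only [Set.mem_preimage, Set.mem_ofPred_eq, not_forall] at hxz hyz
  obtain ⟨a, ha, hxa⟩ := hxz
  obtain ⟨b, hb, hyb⟩ := hyz
  rcases h.2 a b (fun w hw => by
    rcases hz (show (⟨w, hS hw⟩ : idempotents K A) ∈ Subtype.val ⁻¹' S from hw) with h | h
    · rw [h a ha, zero_mul]
    · rw [h b hb, mul_zero]) with h | h
  · exact hxa (h x hx)
  · exact hyb (h y hy)

theorem isClosed_eval_eq (a : A) (c : K) :
    IsClosed {x : idempotents K A | (x : Pt K A).ofConv a = c} := by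
  have h : IsClosed {x : Pt K A | x.ofConv a = c} := by
    rw [isClosed_iff_zeroLocus]
    refine ⟨{a - algebraMap K A c}, ?_⟩
    ext x
    simp [sub_eq_zero]
  exact h.preimage continuous_subtype_val

/-- A regular function with finitely many values is constant on irreducible sets. -/
theorem eval_eq_of_isIrreducible {C : Set (idempotents K A)} (hC : IsIrreducible C) {a : A}
    (s : Finset K) (hs : ∀ x ∈ C, (x : Pt K A).ofConv a ∈ s) {x y : idempotents K A}
    (hx : x ∈ C) (hy : y ∈ C) : (x : Pt K A).ofConv a = (y : Pt K A).ofConv a := by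
  classical
  obtain ⟨z, hz, hCz⟩ := isIrreducible_iff_sUnion_isClosed.1 hC
    (s.image fun c => {x : idempotents K A | (x : Pt K A).ofConv a = c})
    (fun z hz => by
      obtain ⟨c, -, rfl⟩ := Finset.mem_image.1 hz
      exact isClosed_eval_eq a c)
    (fun x hx => ⟨_, Finset.mem_coe.2 (Finset.mem_image_of_mem _ (hs x hx)), rfl⟩)
  obtain ⟨c, -, rfl⟩ := Finset.mem_image.1 hz
  exact (hCz hx).trans (hCz hy).symm

theorem trace_mem_image_of_isIdempotentElem {V : Type*} [AddCommGroup V] [Module K V]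
    [Module.Finite K V] [DecidableEq K] {p : Module.End K V} (hp : IsIdempotentElem p) :
    LinearMap.trace K V p ∈
      (Finset.range (Module.finrank K V + 1)).image (Nat.cast : ℕ → K) := by
  rw [(LinearMap.IsIdempotentElem.isProj_range p hp).trace]
  exact Finset.mem_image_of_mem _
    (Finset.mem_range.2 (Nat.lt_succ_of_le (Submodule.finrank_le _)))

/-- Nested idempotent operators of equal trace are equal. -/
theorem eq_of_trace_eq [CharZero K] {V : Type*} [AddCommGroup V] [Module K V] [Module.Finite K V]
    {p q : Module.End K V} (hp : IsIdempotentElem p) (hq : IsIdempotentElem q) (hpq : p * q = q)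
    (hqp : q * p = q) (h : LinearMap.trace K V p = LinearMap.trace K V q) : p = q := by
  have h3 : IsIdempotentElem (p - q) := by
    rw [IsIdempotentElem, sub_mul, mul_sub, mul_sub, hp.eq, hq.eq, hpq, hqp, sub_self, sub_zero]
  exact sub_eq_zero.1 ((LinearMap.IsIdempotentElem.trace_eq_zero_iff h3).1
    (by rw [map_sub, h, sub_self]))

theorem isClosed_singleton_idempotents (x : idempotents K A) :
    IsClosed ({x} : Set (idempotents K A)) := by
  have h : IsClosed {y : Pt K A | ∀ a : A, y.ofConv a = (x : Pt K A).ofConv a} := by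
    rw [isClosed_iff_zeroLocus]
    refine ⟨RingHom.ker (x : Pt K A).ofConv, ?_⟩
    ext y
    refine ⟨fun h a ha => by rw [h]; exact ha, fun h a => ?_⟩
    have := h (a - algebraMap K A ((x : Pt K A).ofConv a)) (by simp [RingHom.mem_ker])
    simpa [sub_eq_zero] using this
  convert h.preimage continuous_subtype_val
  ext y
  exact ⟨fun h => by rw [Set.mem_singleton_iff.1 h]; exact fun _ => rfl,
    fun h => Subtype.ext (Pt.ext h)⟩

theorem conjClass_eq_singleton {x z : Pt K A} (hz : z ∈ conjClass x)
    (hc : z ∈ Submonoid.center (Pt K A)) : conjClass x = {z} := by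
  refine Set.eq_singleton_iff_unique_mem.2 ⟨hz, fun y hy => ?_⟩
  obtain ⟨g, rfl⟩ := mem_conjClass_trans (mem_conjClass_symm hz) hy
  rw [Submonoid.mem_center_iff.1 hc, mul_assoc, Units.mul_inv, mul_one]

theorem not_isAffineLine_singleton (z : Pt K A) : ¬ IsAffineLine ({z} : Set (Pt K A)) := by
  rintro ⟨-, ⟨E⟩⟩
  have hmax : (vanishingIdeal ({z} : Set (Pt K A))).IsMaximal := by
    have h : vanishingIdeal ({z} : Set (Pt K A)) = RingHom.ker z.ofConv := by
      simp [vanishingIdeal]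
    rw [h]
    exact RingHom.ker_isMaximal_of_surjective z.ofConv fun c => ⟨algebraMap K A c, by simp⟩
  have h1 : IsField (Polynomial K) :=
    E.symm.toMulEquiv.isField ((Ideal.Quotient.maximal_ideal_iff_isField_quotient _).1 hmax)
  exact Polynomial.not_isField K h1

variable [IsAlgClosed K] [IsDomain A] [Algebra.FiniteType K A]

theorem isIrreducible_conjClass {e : Pt K A} (he : e * e = e) :
    IsIrreducible (Subtype.val ⁻¹' conjClass e : Set (idempotents K A)) :=
  (irr_conjClass e).isIrreducible_preimage fun _ hx => idempotent_of_mem_conjClass he hx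

/-- A component that is contained in a conjugacy class is that class. -/
theorem image_eq_conjClass {C : Set (idempotents K A)}
    (hC : C ∈ irreducibleComponents (idempotents K A)) {e : idempotents K A}
    (h : Subtype.val '' C ⊆ conjClass (e : Pt K A)) : Subtype.val '' C = conjClass (e : Pt K A) := by
  refine h.antisymm fun x hx => ?_
  exact ⟨⟨x, idempotent_of_mem_conjClass e.2 hx⟩,
    hC.2 (isIrreducible_conjClass e.2) (Set.image_subset_iff.1 h) hx, rfl⟩

theorem mem_center_of_units {x : Pt K A} (h : ∀ g : (Pt K A)ˣ, (g : Pt K A) * x = x * g) :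
    x ∈ Submonoid.center (Pt K A) := by
  rw [Submonoid.mem_center_iff]
  intro y
  refine Pt.ext fun a => ?_
  rw [← eval_rtrans, ← eval_ltrans]
  congr 1
  exact eq_of_unit_eval_eq (K := K) fun g => by rw [eval_rtrans, eval_ltrans, h]

/-- An open point is dense in its irreducible conjugacy class; being closed as well, it is the whole
class. -/
theorem mem_center_of_isOpen_singleton {x : idempotents K A}
    (hx : IsOpen ({x} : Set (idempotents K A))) :
    (x : Pt K A) ∈ Submonoid.center (Pt K A) := by
  have hself : x ∈ (Subtype.val ⁻¹' conjClass (x : Pt K A) : Set (idempotents K A)) :=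
    ⟨1, by simp⟩
  have h := subset_closure_inter_of_isPreirreducible_of_isOpen
    (isIrreducible_conjClass x.2).isPreirreducible hx ⟨x, hself, rfl⟩
  have h1 := h.trans ((closure_mono Set.inter_subset_right).trans
    (isClosed_singleton_idempotents x).closure_subset)
  refine mem_center_of_units fun g => ?_
  have hg : ((g : Pt K A) * (x : Pt K A) * ((g⁻¹ : (Pt K A)ˣ) : Pt K A)) ∈ conjClass (x : Pt K A) := ⟨g, rfl⟩
  have h2 : ((g : Pt K A) * (x : Pt K A) * ((g⁻¹ : (Pt K A)ˣ) : Pt K A)) = x := congrArg Subtype.val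
    (h1 (show (⟨_, idempotent_of_mem_conjClass x.2 hg⟩ : idempotents K A) ∈ _ from hg))
  calc (g : Pt K A) * x = g * x * ((g⁻¹ : (Pt K A)ˣ) : Pt K A) * g := by
        rw [mul_assoc, Units.inv_mul, mul_one]
    _ = x * g := by rw [h2]

variable [CharZero K]

/-- In a commutative monoid the irreducible sets of idempotents are points. -/
theorem eq_of_isIrreducible_of_commute (hcomm : ∀ x y : Pt K A, x * y = y * x)
    {C : Set (idempotents K A)} (hC : IsIrreducible C) {e f : idempotents K A} (he : e ∈ C)
    (hf : f ∈ C) : e = f := by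
  classical
  have key : ∀ (a : A) (e f : idempotents K A), e ∈ C → f ∈ C →
      rrep (K := K) {a} e = rrep {a} ((e : Pt K A) * (f : Pt K A)) := by
    intro a e f he hf
    have := finite_rspan (K := K) (Set.finite_singleton a)
    have hid : ∀ x : Pt K A, x * x = x → IsIdempotentElem (rrep (K := K) {a} x) :=
      fun x hx => by rw [IsIdempotentElem, ← map_mul, hx]
    have hee : (e : Pt K A) * e = e := e.2
    obtain ⟨b, hb⟩ := exists_matrix_coeff {a} (LinearMap.trace K (rspan K {a}))
    have hprod : ∀ x : idempotents K A, ((e : Pt K A) * (x : Pt K A)) * (e * x) = e * x := fun x => by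
      have hx : (x : Pt K A) * x = x := x.2
      rw [mul_assoc, ← mul_assoc (x : Pt K A), hcomm x e, mul_assoc, hx, ← mul_assoc, hee]
    -- The trace of the idempotent operator of e * x is its rank, one of finitely many integers, so
    -- it is constant for x in `C`; comparing x = e with x = f gives nested idempotents of equal
    -- rank.
    have h1 := eval_eq_of_isIrreducible hC (a := ltrans (e : Pt K A) b)
      ((Finset.range (Module.finrank K (rspan K {a}) + 1)).image (Nat.cast : ℕ → K))
      (fun x _ => by
        rw [eval_ltrans, hb]
        exact trace_mem_image_of_isIdempotentElem (hid _ (hprod x))) he hf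
    rw [eval_ltrans, eval_ltrans, hb, hb, hee] at h1
    have h2 : (e : Pt K A) * ((e : Pt K A) * (f : Pt K A)) = e * f := by rw [← mul_assoc, hee]
    refine eq_of_trace_eq (hid _ hee) (hid _ (hprod f)) ?_ ?_ h1
    · rw [← map_mul, h2]
    · rw [← map_mul, hcomm _ (e : Pt K A), h2]
  apply Subtype.ext
  refine Pt.ext fun a => ?_
  have h : rrep (K := K) {a} (e : Pt K A) = rrep {a} (f : Pt K A) := by
    rw [key a e f he hf, hcomm, ← key a f e hf he]
  have h1 := congrArg (fun v : rspan K {a} => (1 : Pt K A).ofConv (v : A))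
    (LinearMap.congr_fun h ⟨a, subset_rspan _ rfl⟩)
  simpa [eval_rtrans] using h1

/-- The dichotomy: either the torus is central and `C` is a point, or the χ's, having values 0 and
1, are constant on `C` and determine the class. -/
theorem image_subset_conjClass (hX : HasCorank K A 1) {C : Set (idempotents K A)}
    (hC : IsIrreducible C) {e : idempotents K A} (he : e ∈ C) :
    Subtype.val '' C ⊆ conjClass (e : Pt K A) := by
  classical
  obtain ⟨T, r, ⟨φ, hinj, -, hφ⟩, -, hdim⟩ := hX
  replace hφ : IsRegularHom φ := hφ
  rintro _ ⟨f, hf, rfl⟩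
  by_cases hd : IsDiagonal φ
  · rw [eq_of_isIrreducible_of_commute (hd.mul_comm hφ hinj hdim) hC hf he]
    exact ⟨1, by simp⟩
  · unfold IsDiagonal at hd
    push Not at hd
    obtain ⟨l, m, f₀, hf₀, hf₀0, hlm⟩ := hd
    obtain ⟨κ, hT⟩ := exists_isToric hφ hinj hdim hlm hf₀ hf₀0
    refine hT.mem_conjClass hφ e.2 f.2 fun l => ?_
    refine eval_eq_of_isIrreducible hC {0, 1} (fun x _ => ?_) he hf
    rcases hT.chi_eq_zero_or_one hφ l x.2 with h | h <;> simp [h]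

end Components

end AffineMonoid

theorem proposition8p1 {K A : Type*} [Field K] [IsAlgClosed K] [CharZero K]
    [CommRing A] [IsDomain A] [IsIntegrallyClosed A] [Bialgebra K A] [Algebra.FiniteType K A]
    (hX : AffineMonoid.HasCorank K A 1) :
    (∀ C ∈ irreducibleComponents (AffineMonoid.idempotents K A),
      ∃ x : AffineMonoid.Pt K A, Subtype.val '' C = AffineMonoid.conjClass x) ∧
    (∀ C ∈ irreducibleComponents (AffineMonoid.idempotents K A),
      AffineMonoid.IsAffineLine (Subtype.val '' C : Set (AffineMonoid.Pt K A)) →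
        Disjoint (Subtype.val '' C : Set (AffineMonoid.Pt K A))
          (Submonoid.center (AffineMonoid.Pt K A) : Set (AffineMonoid.Pt K A))) ∧
    (∀ x : AffineMonoid.idempotents K A, IsOpen ({x} : Set (AffineMonoid.idempotents K A)) →
      (x : AffineMonoid.Pt K A) ∈ Submonoid.center (AffineMonoid.Pt K A)) := by
  have h1 : ∀ C ∈ irreducibleComponents (AffineMonoid.idempotents K A),
      ∃ x : AffineMonoid.Pt K A, Subtype.val '' C = AffineMonoid.conjClass x := by
    intro C hC
    obtain ⟨e, he⟩ := hC.1.nonempty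
    exact ⟨e, AffineMonoid.image_eq_conjClass hC
      (AffineMonoid.image_subset_conjClass hX hC.1 he)⟩
  refine ⟨h1, fun C hC hline => ?_, fun x hx => AffineMonoid.mem_center_of_isOpen_singleton hx⟩
  obtain ⟨x, hx⟩ := h1 C hC
  rw [hx] at hline ⊢
  rw [Set.disjoint_left]
  intro z hz hc
  rw [AffineMonoid.conjClass_eq_singleton hz hc] at hline
  exact AffineMonoid.not_isAffineLine_singleton z hline
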